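/- All circuits are negation normal form circuits (NNFs): finite acyclic circuits with fan-in-2 $\wedge$-gates and unbounded fan-in $\vee$-gates whose input gates are labeled by literals or by the constants $\bot,\top$; the size $|C|$ is the number of gates (input gates included). For a gate $u$, $\mathrm{vars}(u)$ is the set of variables for which a literal appears in the subcircuit rooted at $u$. A vtree for a finite nonempty variable set $X$ is a full rooted binary tree whose leaves are in one-to-one correspondence with $X$; for a node $v$, $\mathrm{vars}(v)$ is the set of variables below $v$, and $v_\ell,v_r$ are the left and right child of an inner node $v$. The vtree is normalized if $|\mathrm{vars}(v_\ell)|\le|\mathrm{vars}(v_r)|$ for every inner node $v$. A structured d-DNNF with respect to a vtree $T$ is an NNF such that (decomposability) the two children of each $\wedge$-gate have disjoint variable sets, (determinism) the functions computed at distinct children of an $\vee$-gate are never simultaneously $1$, and (structuredness) for each $\wedge$-gate there is an inner node $v$ of $T$ such that the variables of one of its children lie in $\mathrm{vars}(v_\ell)$ and those of the other one in $\mathrm{vars}(v_r)$. A sentential decision diagram (SDD) respecting a vtree $T$ is, inductively, either a constant; or a literal of a variable of $T$; or a disjunction of $\wedge$-gates $p_i\wedge s_i$, $i=1,\dots,m$,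 such that for some inner node $v$ of $T$ all $p_i$ are (roots of) SDDs respecting the subtree rooted at $v_\ell$, all $s_i$ are SDDs respecting the subtree rooted at $v_r$, and the functions represented by $p_1,\dots,p_m$ form a partition (they are pairwise disjoint, none is constant $0$, and their disjunction is constant $1$). For a vtree $T$, the modified vtree $T'$ is obtained as follows: every inner node $v$ of $T$ with $|\mathrm{vars}(v)|>2$ gets a new parent $v'$, which takes the place of $v$; the left child of $v'$ is $v$ and its right child is a leaf labeled by a new auxiliary variable (a different one for each $v$). **Theorem.** There is an absolute constant $K$ such that the following holds. Let $T$ be a normalized vtree for a set $X$ of $n\ge 1$ variables, let $f:\{0,1\}^X\to\{0,1\}$, and let $\mathcal D$ and $\overline{\mathcal D}$ be structured d-DNNFs with respect to $T$ that represent $f$ and its complement $\overline f$, respectively. Then the modified vtree $T'$ contains at most $\max(n-2,0)$ auxiliary variables, and there is an SDD $S$ respecting $T'$ that represents $f$ (regarded as a function of the variables in $X$ and the auxiliary variables that does not depend on the latter) with $$|S|\le K\,(|\mathcal D|+|\overline{\mathcal D}|)^2 .$$ -/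

import Mathlib

/-! ### Vtrees -/

/-- Full, rooted binary trees with ordered children whose leaves are labeled by variables. -/
inductive VTree (V : Type*) where
  | leaf (x : V) : VTree V
  | node (l r : VTree V) : VTree V

namespace VTree

/-- The labels of the leaves, from left to right. -/
def leaves {V : Type*} : VTree V → List V
  | leaf x => [x]
  | node l r => leaves l ++ leaves r

/-- The set of variables of a tree. -/
def vars {V : Type*} (T : VTree V) : Set V := {x | x ∈ T.leaves}

/-- `T` is a vtree for the variable set `V`: its leaves are in one-to-one correspondence with
the elements of `V`. -/
def IsVTree {V : Type*} (T : VTree V) : Prop := T.leaves.Nodup ∧ ∀ x : V, x ∈ T.leaves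

/-- `Subtree S T`: the tree `S` is the subtree `T_v` of `T` rooted at some node `v` of `T`. -/
inductive Subtree {V : Type*} (S : VTree V) : VTree V → Prop
  | refl : Subtree S S
  | left {l r : VTree V} : Subtree S l → Subtree S (node l r)
  | right {l r : VTree V} : Subtree S r → Subtree S (node l r)

/-- At each inner node the left subtree has at most as many variables as the right one. -/
def Normalized {V : Type*} (T : VTree V) : Prop :=
  ∀ l r : VTree V, Subtree (node l r) T → l.leaves.length ≤ r.leaves.length

/-- `IsModification T T'`: the tree `T'` is obtained from `T` by giving every inner node `v` of `T`
with more than two variables a new parent `v'`, which takes the place of `v`, whose left child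
is `v` and whose right child is a leaf labeled by an auxiliary variable (an element of `H`).
That the auxiliary variables are pairwise different is expressed by `T'.IsVTree`. -/
inductive IsModification {V H : Type*} : VTree V → VTree (V ⊕ H) → Prop
  | leaf (x : V) : IsModification (leaf x) (leaf (Sum.inl x))
  | small {l r : VTree V} {l' r' : VTree (V ⊕ H)} :
      (node l r).leaves.length ≤ 2 → IsModification l l' → IsModification r r' →
      IsModification (node l r) (node l' r')
  | large {l r : VTree V} {l' r' : VTree (V ⊕ H)} (h : H) :
      2 < (node l r).leaves.length → IsModification l l' → IsModification r r' →
      IsModification (node l r) (node (node l' r') (leaf (Sum.inr h)))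

end VTree

/-! ### Negation normal form circuits -/

/-- The label of a gate together with its children, which are elements of `N`: literals (`x` for
`lit x true`, the negation of `x` for `lit x false`), Boolean constants, conjunctions of fan-in
two, and disjunctions of arbitrary fan-in. -/
inductive Gate (V : Type*) (N : Type*) where
  | lit (x : V) (sign : Bool) : Gate V N
  | const (b : Bool) : Gate V N
  | and (l r : N) : Gate V N
  | or (s : Set N) : Gate V N

namespace Gate

/-- The set of children of a gate. -/
def children {V N : Type*} : Gate V N → Set N
  | lit _ _ => ∅
  | const _ => ∅
  | and l r => {l, r}
  | or s => s

end Gate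

/-- Negation normal form circuits on the variable set `V`: finite directed acyclic graphs of gates
with a distinguished output gate. -/
structure NNF (V : Type*) where
  /-- the gates, input gates included -/
  Node : Type
  finite : Fintype Node
  gate : Node → Gate V Node
  /-- the graph has no directed cycle -/
  acyclic : WellFounded fun w u : Node => w ∈ (gate u).children
  /-- the output gate -/
  root : Node

namespace NNF

/-- The size of a circuit is the number of its gates. -/
def size {V : Type*} (C : NNF V) : ℕ := @Fintype.card C.Node C.finite

/-- `C.Holds a u`: the gate `u` evaluates to `1` under the assignment `a`. -/
inductive Holds {V : Type*} (C : NNF V) (a : V → Bool) : C.Node → Prop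
  | lit {u : C.Node} {x : V} {b : Bool} : C.gate u = Gate.lit x b → a x = b → Holds C a u
  | const {u : C.Node} : C.gate u = Gate.const true → Holds C a u
  | and {u l r : C.Node} : C.gate u = Gate.and l r → Holds C a l → Holds C a r → Holds C a u
  | or {u w : C.Node} {s : Set C.Node} : C.gate u = Gate.or s → w ∈ s → Holds C a w → Holds C a u

/-- The circuit `C` represents the Boolean function `f`. -/
def Represents {V : Type*} (C : NNF V) (f : (V → Bool) → Bool) : Prop :=
  ∀ a : V → Bool, C.Holds a C.root ↔ f a = true

/-- The variables for which a literal appears in the subgraph rooted at `u`. -/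
def vars {V : Type*} (C : NNF V) (u : C.Node) : Set V :=
  {x | ∃ (w : C.Node) (b : Bool),
    Relation.ReflTransGen (fun p c : C.Node => c ∈ (C.gate p).children) u w ∧
      C.gate w = Gate.lit x b}

/-- The children of each conjunction are reachable from disjoint sets of variables. -/
def Decomposable {V : Type*} (C : NNF V) : Prop :=
  ∀ u l r : C.Node, C.gate u = Gate.and l r → Disjoint (C.vars l) (C.vars r)

/-- The functions computed at the children of each disjunction are pairwise not simultaneously
satisfiable. -/
def Deterministic {V : Type*} (C : NNF V) : Prop :=
  ∀ (u : C.Node) (s : Set C.Node), C.gate u = Gate.or s →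
    ∀ v ∈ s, ∀ w ∈ s, v ≠ w → ∀ a : V → Bool, ¬ (C.Holds a v ∧ C.Holds a w)

/-- Each conjunction respects some inner node of `T`: the variables of one of its children are
below the left child, the variables of the other one are below the right child of that node.
The two children of a conjunction are regarded as unordered, so that this notion does not change
if the children of inner nodes of `T` are switched. -/
def Respects {V : Type*} (C : NNF V) (T : VTree V) : Prop :=
  ∀ u l r : C.Node, C.gate u = Gate.and l r →
    ∃ vl vr : VTree V, VTree.Subtree (VTree.node vl vr) T ∧
      ((C.vars l ⊆ vl.vars ∧ C.vars r ⊆ vr.vars) ∨ (C.vars l ⊆ vr.vars ∧ C.vars r ⊆ vl.vars))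

/-- Structured d-DNNFs with respect to the vtree `T`. -/
def IsStructuredDDNNF {V : Type*} (C : NNF V) (T : VTree V) : Prop :=
  C.Decomposable ∧ C.Deterministic ∧ C.Respects T

/-- `C.IsSDDAt u T`: the subcircuit of `C` rooted at `u` is a sentential decision diagram that
respects `T`. In the third case `p g` and `q g` are the prime and the sub of the conjunction `g`;
the last three hypotheses say that the functions represented at the primes form a partition. -/
inductive IsSDDAt {V : Type*} (C : NNF V) : C.Node → VTree V → Prop
  | const {u : C.Node} {T : VTree V} {b : Bool} : C.gate u = Gate.const b → IsSDDAt C u T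
  | lit {u : C.Node} {T : VTree V} {x : V} {b : Bool} :
      C.gate u = Gate.lit x b → x ∈ T.vars → IsSDDAt C u T
  | decomposition {u : C.Node} {T vL vR : VTree V} {s : Set C.Node} (p q : C.Node → C.Node) :
      C.gate u = Gate.or s →
      VTree.Subtree (VTree.node vL vR) T →
      (∀ g ∈ s, C.gate g = Gate.and (p g) (q g)) →
      (∀ g ∈ s, IsSDDAt C (p g) vL) →
      (∀ g ∈ s, IsSDDAt C (q g) vR) →
      (∀ g ∈ s, ∀ h ∈ s, g ≠ h → ∀ a : V → Bool, ¬ (C.Holds a (p g) ∧ C.Holds a (p h))) →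
      (∀ g ∈ s, ∃ a : V → Bool, C.Holds a (p g)) →
      (∀ a : V → Bool, ∃ g ∈ s, C.Holds a (p g)) →
      IsSDDAt C u T

/-- Sentential decision diagrams respecting the vtree `T`. -/
def IsSDD {V : Type*} (C : NNF V) (T : VTree V) : Prop := C.IsSDDAt C.root T

end NNF

/-! Join the circuits for `f` and its complement by one disjunction: the result `C` is a structured
d-DNNF for the constant 1. For a gate `u` of `C`, its home is the smallest subtree containing its
variables; let `W` be the variables of the home. Fix the variables outside `W` by an assignment (the
context) under which a descent from the output gate, always towards `W`, reaches `u`. The descents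
from the output gate end in literals or conjunctions with all variables in `W`; the satisfiable ones
are the pieces of `u`. Determinism makes the pieces pairwise disjoint, and since `C` is constant 1
they cover every assignment (`pieces_disjoint`, `exists_mem_pieces`). So they form a partition, and
a nonconstant `u` is the disjunction of the pieces it reaches, its negation that of the others
(`holds_iff_reach_piece`).

This gives a decomposition of `u` and of its negation: the primes are the pieces and the subs are
constants. The pieces use both sides of the home `v`, so they are placed at `v`, and the auxiliary
leaf is the right child of its new parent `v'`. A piece that is a conjunction of `p` and `q`,
separated by its home, becomes the decomposition with elements `p ∧ q` and `¬p ∧ ⊥`. Both parts are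
again reached in some context (`useful_of_mem_pieces`) and have smaller homes, so the recursion
closes. Homes with at most two variables are treated directly. Elements are indexed by pairs of
gates and a sign, whence the quadratic size. -/

namespace VTree

variable {V H : Type*}

/-! ### Subtrees of a vtree and the smallest subtree containing a set of variables. -/

theorem leaves_ne_nil (T : VTree V) : T.leaves ≠ [] := by
  induction T with
  | leaf x => simp [leaves]
  | node l r hl hr => simp [leaves, hl]

theorem length_leaves_pos (T : VTree V) : 0 < T.leaves.length :=
  List.length_pos_iff.2 T.leaves_ne_nil

theorem vars_node (l r : VTree V) : (node l r).vars = l.vars ∪ r.vars := by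
  ext x; simp [vars, leaves]

theorem Subtree.trans {R S T : VTree V} (h : Subtree R S) (h' : Subtree S T) : Subtree R T := by
  induction h' with
  | refl => exact h
  | left _ ih => exact ih.left
  | right _ ih => exact ih.right

theorem Subtree.sublist {S T : VTree V} (h : Subtree S T) : S.leaves.Sublist T.leaves := by
  induction h with
  | refl => exact List.Sublist.refl _
  | left _ ih => exact ih.trans (List.sublist_append_left _ _)
  | right _ ih => exact ih.trans (List.sublist_append_right _ _)

theorem Subtree.vars_subset {S T : VTree V} (h : Subtree S T) : S.vars ⊆ T.vars :=
  fun _ hx => h.sublist.subset hx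

theorem Subtree.nodup {S T : VTree V} (h : Subtree S T) (hT : T.leaves.Nodup) :
    S.leaves.Nodup := hT.sublist h.sublist

theorem nodup_node {l r : VTree V} : (node l r).leaves.Nodup ↔
    l.leaves.Nodup ∧ r.leaves.Nodup ∧ Disjoint l.vars r.vars := by
  simp only [leaves, List.nodup_append', Set.disjoint_left, vars, List.Disjoint, Set.mem_ofPred_eq]

/-- Two subtrees of a tree without repeated labels are nested or have no common variable. -/
theorem Subtree.comparable_or_disjoint {R S T : VTree V} (hT : T.leaves.Nodup)
    (hR : Subtree R T) (hS : Subtree S T) :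
    Subtree R S ∨ Subtree S R ∨ Disjoint R.vars S.vars := by
  induction T with
  | leaf x =>
    cases hR
    exact Or.inr (Or.inl hS)
  | node l r ihl ihr =>
    obtain ⟨nl, nr, d⟩ := nodup_node.1 hT
    cases hR with
    | refl => exact Or.inr (Or.inl hS)
    | left hR =>
      cases hS with
      | refl => exact Or.inl hR.left
      | left hS => exact ihl nl hR hS
      | right hS => exact Or.inr (Or.inr (d.mono hR.vars_subset hS.vars_subset))
    | right hR =>
      cases hS with
      | refl => exact Or.inl hR.right
      | left hS => exact Or.inr (Or.inr (d.symm.mono hR.vars_subset hS.vars_subset))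
      | right hS => exact ihr nr hR hS

open Classical in
/-- The smallest subtree of `T` that contains the variables in `s`. -/
noncomputable def locate (s : Set V) : VTree V → VTree V
  | leaf x => leaf x
  | node l r => if s ⊆ l.vars then locate s l else if s ⊆ r.vars then locate s r else node l r

theorem locate_subtree (s : Set V) (T : VTree V) : Subtree (locate s T) T := by
  induction T with
  | leaf x => exact Subtree.refl
  | node l r ihl ihr =>
    unfold locate
    split_ifs
    · exact ihl.left
    · exact ihr.right
    · exact Subtree.refl

theorem subset_locate {s : Set V} {T : VTree V} (h : s ⊆ T.vars) : s ⊆ (locate s T).vars := by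
  induction T with
  | leaf x => exact h
  | node l r ihl ihr =>
    unfold locate
    split_ifs with h1 h2
    · exact ihl h1
    · exact ihr h2
    · exact h

/-- Nonemptiness matters: the empty set lies in every left subtree, so for it the search ends at the
leftmost leaf of `T`, wherever `S` is. -/
theorem locate_eq_of_subtree {s : Set V} (hs : s.Nonempty) {S T : VTree V}
    (hT : T.leaves.Nodup) (h : Subtree S T) (hsub : s ⊆ S.vars) :
    locate s T = locate s S := by
  induction h with
  | refl => rfl
  | left h ih =>
    rw [locate, if_pos (hsub.trans h.vars_subset), ih (nodup_node.1 hT).1]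
  | right h ih =>
    obtain ⟨-, nr, d⟩ := nodup_node.1 hT
    have hr := hsub.trans h.vars_subset
    rw [locate, if_neg, if_pos hr, ih nr]
    intro hl
    obtain ⟨x, hx⟩ := hs
    exact Set.disjoint_left.1 d (hl hx) (hr hx)

theorem locate_subtree_of_subset {s : Set V} (hs : s.Nonempty) {S T : VTree V}
    (hT : T.leaves.Nodup) (h : Subtree S T) (hsub : s ⊆ S.vars) :
    Subtree (locate s T) S :=
  locate_eq_of_subtree hs hT h hsub ▸ locate_subtree s S

/-! ### Modifications -/

namespace IsModification

theorem inl_mem {T : VTree V} {T' : VTree (V ⊕ H)} (h : IsModification T T') {x : V}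
    (hx : x ∈ T.vars) : Sum.inl x ∈ T'.vars := by
  induction h with
  | leaf y => simpa [vars, leaves] using hx
  | small _ _ _ ihl ihr =>
    rw [vars_node] at hx ⊢
    exact hx.imp ihl ihr
  | large _ _ _ _ ihl ihr =>
    rw [vars_node] at hx
    rw [vars_node, vars_node]
    exact Or.inl (hx.imp ihl ihr)

/-- The node of the modified tree that corresponds to a given inner node. -/
theorem exists_subtree {S T : VTree V} {T' : VTree (V ⊕ H)} (h : IsModification T T')
    (hS : Subtree S T) : ∃ S', IsModification S S' ∧ Subtree S' T' := by
  induction h with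
  | leaf y =>
    cases hS
    exact ⟨_, .leaf y, .refl⟩
  | small hle hl hr ihl ihr =>
    cases hS with
    | refl => exact ⟨_, .small hle hl hr, .refl⟩
    | left hS =>
      obtain ⟨S', h1, h2⟩ := ihl hS
      exact ⟨S', h1, h2.left⟩
    | right hS =>
      obtain ⟨S', h1, h2⟩ := ihr hS
      exact ⟨S', h1, h2.right⟩
  | large x hlt hl hr ihl ihr =>
    cases hS with
    | refl => exact ⟨_, .large x hlt hl hr, .refl⟩
    | left hS =>
      obtain ⟨S', h1, h2⟩ := ihl hS
      exact ⟨S', h1, h2.left.left⟩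
    | right hS =>
      obtain ⟨S', h1, h2⟩ := ihr hS
      exact ⟨S', h1, h2.right.left⟩

theorem exists_node {l r : VTree V} {T' : VTree (V ⊕ H)} (h : IsModification (node l r) T') :
    ∃ l' r', IsModification l l' ∧ IsModification r r' ∧ Subtree (node l' r') T' := by
  cases h with
  | small _ hl hr => exact ⟨_, _, hl, hr, .refl⟩
  | large _ _ hl hr => exact ⟨_, _, hl, hr, Subtree.refl.left⟩

end IsModification

/-- The number of inner nodes with more than two variables. -/
def numLarge : VTree V → ℕ
  | leaf _ => 0
  | node l r => numLarge l + numLarge r + if 2 < (node l r).leaves.length then 1 else 0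

/-- A full tree with `n ≥ 2` leaves has `n - 1` inner nodes, at least one of which has two leaves as
children. Truncated subtraction covers the single leaf. -/
theorem numLarge_le (T : VTree V) : T.numLarge ≤ T.leaves.length - 2 := by
  induction T with
  | leaf x => simp [numLarge]
  | node l r ihl ihr =>
    have hl := l.length_leaves_pos
    have hr := r.length_leaves_pos
    simp only [numLarge, leaves, List.length_append]
    split_ifs <;> omega

theorem exists_isModification (T : VTree V) (L : List H) (hL : L.length = T.numLarge) :
    ∃ T' : VTree (V ⊕ H), IsModification T T' ∧
      T'.leaves.Perm (T.leaves.map Sum.inl ++ L.map Sum.inr) := by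
  induction T generalizing L with
  | leaf x =>
    obtain rfl : L = [] := List.length_eq_zero_iff.1 hL
    exact ⟨_, .leaf x, by simp [leaves]⟩
  | node l r ihl ihr =>
    have key : ∀ L : List H, L.length = l.numLarge + r.numLarge →
        ∃ l' r' : VTree (V ⊕ H), IsModification l l' ∧ IsModification r r' ∧
          (l'.leaves ++ r'.leaves).Perm
            ((l.leaves ++ r.leaves).map Sum.inl ++ L.map Sum.inr) := by
      intro L hL
      obtain ⟨l', hl, pl⟩ := ihl (L.take l.numLarge) (by simp [hL])
      obtain ⟨r', hr, pr⟩ := ihr (L.drop l.numLarge) (by simp [hL])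
      refine ⟨l', r', hl, hr, (pl.append pr).trans ?_⟩
      conv_rhs => rw [← List.take_append_drop l.numLarge L]
      simp only [List.map_append, List.append_assoc]
      refine List.Perm.append_left _ ?_
      simp only [← List.append_assoc]
      exact List.Perm.append_right _ List.perm_append_comm
    by_cases h : 2 < (node l r).leaves.length
    · rw [numLarge, if_pos h] at hL
      obtain _ | ⟨x, L⟩ := L
      · simp at hL
      obtain ⟨l', r', hl, hr, p⟩ := key L (by simpa using hL)
      refine ⟨_, .large x h hl hr, ?_⟩
      simp only [leaves, List.map_cons]
      refine (p.append_right _).trans ?_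
      rw [List.append_assoc]
      exact List.Perm.append_left _ List.perm_append_comm
    · rw [numLarge, if_neg h] at hL
      obtain ⟨l', r', hl, hr, p⟩ := key L hL
      exact ⟨_, .small (not_lt.1 h) hl hr, p⟩

theorem IsVTree.exists_isModification [Fintype V] {T : VTree V} (hT : T.IsVTree) :
    ∃ k ≤ Fintype.card V - 2, ∃ T' : VTree (V ⊕ Fin k), T'.IsVTree ∧ IsModification T T' := by
  classical
  have hlen : T.leaves.length ≤ Fintype.card V := hT.1.length_le_card
  obtain ⟨T', hmod, p⟩ := T.exists_isModification (List.finRange T.numLarge) (by simp)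
  refine ⟨T.numLarge, T.numLarge_le.trans (by omega), T', ⟨?_, ?_⟩, hmod⟩
  · rw [p.nodup_iff, List.nodup_append']
    refine ⟨hT.1.map Sum.inl_injective, (List.nodup_finRange _).map Sum.inr_injective, ?_⟩
    simp [List.Disjoint]
  · intro x
    rw [p.mem_iff]
    cases x <;> simp [hT.2]

end VTree

/-! ### Evaluation and variables of gates. -/

namespace NNF

variable {V : Type*} {C : NNF V}

theorem holds_lit_iff {a : V → Bool} {u : C.Node} {x : V} {b : Bool}
    (h : C.gate u = Gate.lit x b) : C.Holds a u ↔ a x = b := by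
  refine ⟨fun H => ?_, fun H => .lit h H⟩
  cases H <;> simp_all

theorem holds_const_iff {a : V → Bool} {u : C.Node} {b : Bool}
    (h : C.gate u = Gate.const b) : C.Holds a u ↔ b = true := by
  refine ⟨fun H => ?_, fun H => .const (H ▸ h)⟩
  cases H <;> simp_all

theorem holds_and_iff {a : V → Bool} {u l r : C.Node}
    (h : C.gate u = Gate.and l r) : C.Holds a u ↔ C.Holds a l ∧ C.Holds a r := by
  refine ⟨fun H => ?_, fun H => .and h H.1 H.2⟩
  cases H <;> simp_all

theorem holds_or_iff {a : V → Bool} {u : C.Node} {s : Set C.Node}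
    (h : C.gate u = Gate.or s) : C.Holds a u ↔ ∃ w ∈ s, C.Holds a w := by
  refine ⟨fun H => ?_, fun ⟨w, hw, H⟩ => .or h hw H⟩
  cases H with
  | or h' hw H =>
    rw [h] at h'
    cases h'
    exact ⟨_, hw, H⟩
  | _ => simp_all

theorem vars_subset_of_mem_children {u w : C.Node} (h : w ∈ (C.gate u).children) :
    C.vars w ⊆ C.vars u :=
  fun _ ⟨t, b, hr, ht⟩ => ⟨t, b, .head h hr, ht⟩

theorem mem_vars_iff {u : C.Node} {x : V} : x ∈ C.vars u ↔
    (∃ b, C.gate u = Gate.lit x b) ∨ ∃ w ∈ (C.gate u).children, x ∈ C.vars w := by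
  constructor
  · rintro ⟨t, b, hr, ht⟩
    rcases Relation.ReflTransGen.cases_head hr with rfl | ⟨w, hw, hr⟩
    · exact Or.inl ⟨b, ht⟩
    · exact Or.inr ⟨w, hw, t, b, hr, ht⟩
  · rintro (⟨b, h⟩ | ⟨w, hw, hx⟩)
    · exact ⟨u, b, .refl, h⟩
    · exact vars_subset_of_mem_children hw hx

theorem vars_lit {u : C.Node} {x : V} {b : Bool} (h : C.gate u = Gate.lit x b) :
    C.vars u = {x} := by
  ext y
  rw [mem_vars_iff, h]
  simp [Gate.children, eq_comm]

theorem vars_const {u : C.Node} {b : Bool} (h : C.gate u = Gate.const b) :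
    C.vars u = ∅ := by
  ext y
  rw [mem_vars_iff, h]
  simp [Gate.children]

theorem vars_and {u l r : C.Node} (h : C.gate u = Gate.and l r) :
    C.vars u = C.vars l ∪ C.vars r := by
  ext y
  rw [mem_vars_iff, h]
  simp [Gate.children]

/-- The function computed at a gate depends only on the variables of the gate. -/
theorem holds_congr {a b : V → Bool} (u : C.Node) (h : ∀ x ∈ C.vars u, a x = b x) :
    C.Holds a u ↔ C.Holds b u := by
  induction u using C.acyclic.induction with
  | _ u ih =>
    have ih' : ∀ w ∈ (C.gate u).children, (C.Holds a w ↔ C.Holds b w) :=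
      fun w hw => ih w hw fun x hx => h x (vars_subset_of_mem_children hw hx)
    match hg : C.gate u with
    | .lit x c => rw [holds_lit_iff hg, holds_lit_iff hg, h x (by simp [vars_lit hg])]
    | .const c => rw [holds_const_iff hg, holds_const_iff hg]
    | .and l r =>
      rw [holds_and_iff hg, holds_and_iff hg, ih' l (by simp [hg, Gate.children]),
        ih' r (by simp [hg, Gate.children])]
    | .or s =>
      rw [holds_or_iff hg, holds_or_iff hg]
      exact exists_congr fun w => and_congr_right fun hw => ih' w (by rwa [hg])

/-! ### Descents towards a set of variables and their terminal gates. -/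

/-- One step of the descent towards the variables in `W`, where `b` is an assignment to the
remaining variables: from a disjunction to any child, from a conjunction to its only child with
variables in `W`, provided that the other child is satisfied by `b`. -/
inductive Step (C : NNF V) (b : V → Bool) (W : Set V) : C.Node → C.Node → Prop
  | or {u w : C.Node} {s : Set C.Node} : C.gate u = Gate.or s → w ∈ s → Step C b W u w
  | left {u l r : C.Node} : C.gate u = Gate.and l r → ¬ Disjoint (C.vars l) W →
      Disjoint (C.vars r) W → C.Holds b r → Step C b W u l
  | right {u l r : C.Node} : C.gate u = Gate.and l r → ¬ Disjoint (C.vars r) W →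
      Disjoint (C.vars l) W → C.Holds b l → Step C b W u r

/-- The gate `w` is reached from `u` by a descent towards `W`. -/
def Reach (C : NNF V) (b : V → Bool) (W : Set V) : C.Node → C.Node → Prop :=
  Relation.ReflTransGen (C.Step b W)

/-- Literals, and conjunctions of two gates that both have variables. -/
def IsAtom (C : NNF V) (u : C.Node) : Prop :=
  (∃ x b, C.gate u = Gate.lit x b) ∨
    ∃ l r, C.gate u = Gate.and l r ∧ (C.vars l).Nonempty ∧ (C.vars r).Nonempty

/-- The gates at which a descent towards `W` ends. -/
def Terminal (C : NNF V) (W : Set V) (u : C.Node) : Prop :=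
  (∀ s, C.gate u ≠ Gate.or s) ∧
    (Disjoint (C.vars u) W ∨ C.IsAtom u ∧ C.vars u ⊆ W)

variable {a b : V → Bool} {W : Set V}

theorem Step.mem_children {u w : C.Node} (h : C.Step b W u w) : w ∈ (C.gate u).children := by
  cases h with
  | or hg hw => rwa [hg]
  | left hg => simp [hg, Gate.children]
  | right hg => simp [hg, Gate.children]

theorem Step.holds {u w : C.Node} (h : C.Step b W u w) (hab : ∀ x ∉ W, a x = b x)
    (hw : C.Holds a w) : C.Holds a u := by
  have key : ∀ t, Disjoint (C.vars t) W → C.Holds b t → C.Holds a t := fun t hd ht =>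
    (holds_congr t fun x hx => hab x (Set.disjoint_left.1 hd hx)).2 ht
  cases h with
  | or hg hws => exact .or hg hws hw
  | left hg _ hd hr => exact .and hg hw (key _ hd hr)
  | right hg _ hd hl => exact .and hg (key _ hd hl) hw

/-- At a disjunction this is determinism; at a conjunction `W` alone selects the child, since
exactly one child meets `W`. -/
theorem Step.unique (hC : C.Deterministic) {u v w : C.Node} (hv : C.Step b W u v)
    (hw : C.Step b W u w) (hav : C.Holds a v) (haw : C.Holds a w) : v = w := by
  cases hv with
  | or hg hvs =>
    cases hw with
    | or hg' hws =>
      rw [hg] at hg'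
      cases hg'
      by_contra hne
      exact hC _ _ hg _ hvs _ hws hne a ⟨hav, haw⟩
    | left hg' => simp [hg] at hg'
    | right hg' => simp [hg] at hg'
  | left hg h1 h2 =>
    cases hw with
    | or hg' => simp [hg] at hg'
    | left hg' =>
      rw [hg] at hg'
      cases hg'
      rfl
    | right hg' h1' =>
      rw [hg] at hg'
      cases hg'
      exact absurd h2 h1'
  | right hg h1 h2 =>
    cases hw with
    | or hg' => simp [hg] at hg'
    | left hg' h1' =>
      rw [hg] at hg'
      cases hg'
      exact absurd h2 h1'
    | right hg' =>
      rw [hg] at hg'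
      cases hg'
      rfl

/-- A step from a conjunction needs exactly one child meeting `W`. If the gate avoids `W`, no child
does; if it is an atom inside `W`, both do. -/
theorem Terminal.not_step {u w : C.Node} (h : C.Terminal W u) : ¬ C.Step b W u w := by
  obtain ⟨hor, h⟩ := h
  have key : ∀ {l r}, C.gate u = Gate.and l r →
      (Disjoint (C.vars l) W ∧ Disjoint (C.vars r) W) ∨
        (¬ Disjoint (C.vars l) W ∧ ¬ Disjoint (C.vars r) W) := by
    intro l r hg
    rw [vars_and hg, Set.disjoint_union_left, Set.union_subset_iff] at h
    refine h.imp_right ?_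
    rintro ⟨ha, hl, hr⟩
    obtain ⟨x, c, hx⟩ | ⟨l', r', hg', hl', hr'⟩ := ha
    · simp [hg] at hx
    · rw [hg] at hg'
      cases hg'
      obtain ⟨x, hx⟩ := hl'
      obtain ⟨y, hy⟩ := hr'
      exact ⟨Set.not_disjoint_iff.2 ⟨x, hx, hl hx⟩, Set.not_disjoint_iff.2 ⟨y, hy, hr hy⟩⟩
  intro hs
  cases hs with
  | or hg => exact hor _ hg
  | left hg h1 h2 => have := key hg; tauto
  | right hg h1 h2 => have := key hg; tauto

theorem Terminal.eq_of_reach {u w : C.Node} (h : C.Terminal W u) (hr : C.Reach b W u w) :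
    u = w := by
  rcases Relation.ReflTransGen.cases_head hr with rfl | ⟨v, hv, -⟩
  · rfl
  · exact absurd hv h.not_step

theorem Reach.holds {u w : C.Node} (h : C.Reach b W u w) (hab : ∀ x ∉ W, a x = b x)
    (hw : C.Holds a w) : C.Holds a u := by
  induction h using Relation.ReflTransGen.head_induction_on with
  | refl => exact hw
  | head h _ ih => exact h.holds hab ih

theorem Reach.vars_subset {u w : C.Node} (h : C.Reach b W u w) : C.vars w ⊆ C.vars u := by
  induction h using Relation.ReflTransGen.head_induction_on with
  | refl => exact subset_rfl
  | head h _ ih => exact ih.trans (vars_subset_of_mem_children h.mem_children)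

/-- Satisfaction propagates upwards along a descent, so `a` satisfies every gate on both paths, and
`Step.unique` forces them to coincide. -/
theorem Reach.terminal_unique (hC : C.Deterministic) (hab : ∀ x ∉ W, a x = b x)
    {u v w : C.Node} (hv : C.Reach b W u v) (hw : C.Reach b W u w) (tv : C.Terminal W v)
    (tw : C.Terminal W w) (hav : C.Holds a v) (haw : C.Holds a w) : v = w := by
  induction hv using Relation.ReflTransGen.head_induction_on with
  | refl => exact tv.eq_of_reach hw
  | head h h' ih =>
    rcases Relation.ReflTransGen.cases_head hw with rfl | ⟨t, ht, hw'⟩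
    · exact absurd h tw.not_step
    · obtain rfl := h.unique hC ht (Reach.holds h' hab hav) (Reach.holds hw' hab haw)
      exact ih hw'

/-- A descent remains one if the target set shrinks and the assignment changes only on the
former target set. -/
theorem Reach.mono {W' : Set V} {b' : V → Bool} (hW : W' ⊆ W) (hb : ∀ x ∉ W, b' x = b x)
    {u w : C.Node} (hw : ¬ Disjoint (C.vars w) W') (h : C.Reach b W u w) :
    C.Reach b' W' u w := by
  have key : ∀ t, Disjoint (C.vars t) W → C.Holds b t → C.Holds b' t := fun t hd ht =>
    (holds_congr t fun x hx => hb x (Set.disjoint_left.1 hd hx)).2 ht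
  induction h using Relation.ReflTransGen.head_induction_on with
  | refl => exact .refl
  | head h h' ih =>
    refine .head ?_ ih
    -- Every gate on the path contains the variables of `w`, so the chosen child still meets `W'`.
    have hd := fun hd => hw (Disjoint.mono_left (Reach.vars_subset h') hd)
    cases h with
    | or hg hs => exact .or hg hs
    | left hg _ h2 h3 => exact .left hg hd (h2.mono_right hW) (key _ h2 h3)
    | right hg _ h2 h3 => exact .right hg hd (h2.mono_right hW) (key _ h2 h3)

/-- The children of a conjunction that is not terminal for the variables of a subtree. -/
theorem Respects.disjoint_or_disjoint {T S : VTree V} (hC : C.Respects T) (hT : T.leaves.Nodup)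
    (hS : VTree.Subtree S T) {u l r : C.Node} (hg : C.gate u = Gate.and l r)
    (hu : ¬ C.Terminal S.vars u) :
    Disjoint (C.vars l) S.vars ∨ Disjoint (C.vars r) S.vars := by
  by_contra! hd
  refine hu ⟨by simp [hg], Or.inr ⟨Or.inr ⟨l, r, hg, ?_, ?_⟩, ?_⟩⟩
  · obtain ⟨x, hx, -⟩ := Set.not_disjoint_iff.1 hd.1
    exact ⟨x, hx⟩
  · obtain ⟨x, hx, -⟩ := Set.not_disjoint_iff.1 hd.2
    exact ⟨x, hx⟩
  · obtain ⟨vl, vr, hsub, hv⟩ := hC u l r hg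
    obtain ⟨nl, nr, dis⟩ := VTree.nodup_node.1 (hsub.nodup hT)
    have hlr : C.vars u ⊆ (VTree.node vl vr).vars := by
      rw [vars_and hg, VTree.vars_node]
      rcases hv with hv | hv
      · exact Set.union_subset_union hv.1 hv.2
      · rw [Set.union_comm vl.vars]
        exact Set.union_subset_union hv.1 hv.2
    have aux : ∀ {s t : Set V}, ¬ Disjoint s S.vars → s ⊆ t → ¬ Disjoint t S.vars :=
      fun h hst h' => h (h'.mono_left hst)
    rcases hsub.comparable_or_disjoint hT hS with h | h | h
    · exact hlr.trans h.vars_subset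
    · cases h with
      | refl => exact hlr
      | left h =>
        exfalso
        have : Disjoint vr.vars S.vars := dis.symm.mono_right h.vars_subset
        rcases hv with hv | hv
        · exact aux hd.2 hv.2 this
        · exact aux hd.1 hv.1 this
      | right h =>
        exfalso
        have : Disjoint vl.vars S.vars := dis.mono_right h.vars_subset
        rcases hv with hv | hv
        · exact aux hd.1 hv.1 this
        · exact aux hd.2 hv.2 this
    · exfalso
      rw [vars_and hg] at hlr
      exact aux hd.1 (Set.subset_union_left.trans hlr) h

/-- Every satisfied gate leads to a satisfied terminal gate. -/
theorem Respects.exists_terminal {T S : VTree V} (hC : C.Respects T) (hT : T.leaves.Nodup)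
    (hS : VTree.Subtree S T) (hab : ∀ x ∉ S.vars, a x = b x) (u : C.Node) (hu : C.Holds a u) :
    ∃ w, C.Reach b S.vars u w ∧ C.Terminal S.vars w ∧ C.Holds a w := by
  induction u using C.acyclic.induction with
  | _ u ih =>
    by_cases ht : C.Terminal S.vars u
    · exact ⟨u, .refl, ht, hu⟩
    have next : ∀ w, C.Step b S.vars u w → C.Holds a w →
        ∃ w, C.Reach b S.vars u w ∧ C.Terminal S.vars w ∧ C.Holds a w := by
      intro w hw haw
      obtain ⟨t, h1, h2⟩ := ih w hw.mem_children haw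
      exact ⟨t, .head hw h1, h2⟩
    match hg : C.gate u with
    | .lit x c =>
      refine absurd ⟨by simp [hg], ?_⟩ ht
      rw [vars_lit hg, Set.disjoint_singleton_left, Set.singleton_subset_iff]
      by_cases hx : x ∈ S.vars
      · exact Or.inr ⟨Or.inl ⟨x, c, hg⟩, hx⟩
      · exact Or.inl hx
    | .const c => exact absurd ⟨by simp [hg], Or.inl (by simp [vars_const hg])⟩ ht
    | .or s =>
      obtain ⟨w, hw, haw⟩ := (holds_or_iff hg).1 hu
      exact next w (.or hg hw) haw
    | .and l r =>
      obtain ⟨hl, hr⟩ := (holds_and_iff hg).1 hu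
      have key : ∀ t, Disjoint (C.vars t) S.vars → C.Holds a t → C.Holds b t := fun t hd h =>
        (holds_congr t fun x hx => hab x (Set.disjoint_left.1 hd hx)).1 h
      have hnd : ¬ (Disjoint (C.vars l) S.vars ∧ Disjoint (C.vars r) S.vars) := fun hd =>
        ht ⟨by simp [hg], Or.inl (by rw [vars_and hg, Set.disjoint_union_left]; exact hd)⟩
      rcases hC.disjoint_or_disjoint hT hS hg ht with hd | hd
      · exact next r (.right hg (fun h => hnd ⟨hd, h⟩) hd (key l hd hl)) hr
      · exact next l (.left hg (fun h => hnd ⟨h, hd⟩) hd (key r hd hr)) hl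

end NNF

theorem VTree.Subtree.length_leaves_le {V : Type*} {S T : VTree V} (h : VTree.Subtree S T) :
    S.leaves.length ≤ T.leaves.length := h.sublist.length_le

theorem VTree.length_leaves_lt_node {V : Type*} (l r : VTree V) :
    l.leaves.length < (VTree.node l r).leaves.length ∧
      r.leaves.length < (VTree.node l r).leaves.length := by
  have hl := l.length_leaves_pos
  have hr := r.length_leaves_pos
  simp only [VTree.leaves, List.length_append]
  omega

/-! ### Homes, contexts and pieces of gates. -/

namespace NNF

variable {V : Type*} {C : NNF V} {T : VTree V}

instance (C : NNF V) : Nonempty C.Node := ⟨C.root⟩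

/-- The smallest subtree of `T` that contains the variables of the gate `u`. -/
noncomputable def home (C : NNF V) (T : VTree V) (u : C.Node) : VTree V :=
  VTree.locate (C.vars u) T

/-- The gate `u` computes a constant function. -/
def IsConstant (C : NNF V) (u : C.Node) : Prop :=
  (∀ a, C.Holds a u) ∨ ∀ a, ¬ C.Holds a u

/-- For some assignment the gate `u` is reached from the output gate. -/
def Useful (C : NNF V) (T : VTree V) (u : C.Node) : Prop :=
  ∃ b, C.Reach b (C.home T u).vars C.root u

/-- An assignment for which `u` is reached from the output gate, if there is one. -/
noncomputable def context (C : NNF V) (T : VTree V) (u : C.Node) : V → Bool :=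
  Classical.epsilon fun b => C.Reach b (C.home T u).vars C.root u

/-- The satisfiable terminal gates with variables in the home of `u` that are reached from the
output gate in the context of `u`. -/
def pieces (C : NNF V) (T : VTree V) (u : C.Node) : Set C.Node :=
  {w | C.Reach (C.context T u) (C.home T u).vars C.root w ∧ C.IsAtom w ∧
    C.vars w ⊆ (C.home T u).vars ∧ ∃ a, C.Holds a w}

/-- The gate `w` is a conjunction of `p` and `q`, and its home separates their variables. -/
def Splits (C : NNF V) (T : VTree V) (w p q : C.Node) : Prop :=
  (C.gate w = Gate.and p q ∨ C.gate w = Gate.and q p) ∧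
    (C.vars p).Nonempty ∧ (C.vars q).Nonempty ∧
    ∃ vl vr, C.home T w = VTree.node vl vr ∧ C.vars p ⊆ vl.vars ∧ C.vars q ⊆ vr.vars

theorem Useful.reach_context {u : C.Node} (h : C.Useful T u) :
    C.Reach (C.context T u) (C.home T u).vars C.root u := Classical.epsilon_spec h

theorem home_subtree (u : C.Node) : VTree.Subtree (C.home T u) T := VTree.locate_subtree _ _

theorem vars_subset_home (hT : T.IsVTree) (u : C.Node) : C.vars u ⊆ (C.home T u).vars :=
  VTree.subset_locate fun x _ => hT.2 x

theorem home_subtree_of_subset (hT : T.IsVTree) {u : C.Node} (hu : (C.vars u).Nonempty)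
    {S : VTree V} (hS : VTree.Subtree S T) (h : C.vars u ⊆ S.vars) :
    VTree.Subtree (C.home T u) S := VTree.locate_subtree_of_subset hu hT.1 hS h

theorem IsAtom.vars_nonempty {u : C.Node} (h : C.IsAtom u) : (C.vars u).Nonempty := by
  obtain ⟨x, c, hx⟩ | ⟨l, r, hg, hl, -⟩ := h
  · rw [vars_lit hx]
    exact Set.singleton_nonempty x
  · rw [vars_and hg]
    exact hl.inl

theorem IsAtom.not_or {u : C.Node} (h : C.IsAtom u) (s : Set C.Node) :
    C.gate u ≠ Gate.or s := by
  obtain ⟨x, c, hx⟩ | ⟨l, r, hg, -⟩ := h <;> simp [*]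

theorem home_subtree_of_mem_pieces (hT : T.IsVTree) {u w : C.Node} (hw : w ∈ C.pieces T u) :
    VTree.Subtree (C.home T w) (C.home T u) :=
  home_subtree_of_subset hT hw.2.1.vars_nonempty (home_subtree u) hw.2.2.1

theorem Respects.exists_splits (hC : C.Respects T) (hT : T.IsVTree) {w l r : C.Node}
    (hg : C.gate w = Gate.and l r) (hl : (C.vars l).Nonempty) (hr : (C.vars r).Nonempty) :
    ∃ p q, C.Splits T w p q := by
  obtain ⟨vl, vr, hsub, hv⟩ := hC w l r hg
  have key : ∀ p q, (C.gate w = Gate.and p q ∨ C.gate w = Gate.and q p) →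
      (C.vars p).Nonempty → (C.vars q).Nonempty → C.vars p ⊆ vl.vars → C.vars q ⊆ vr.vars →
      C.Splits T w p q := by
    intro p q hg hp hq hpl hqr
    refine ⟨hg, hp, hq, vl, vr, ?_, hpl, hqr⟩
    have hvars : C.vars w = C.vars p ∪ C.vars q := by
      rcases hg with hg | hg
      · exact vars_and hg
      · rw [vars_and hg, Set.union_comm]
    have hd := (VTree.nodup_node.1 (hsub.nodup hT.1)).2.2
    rw [home, hvars, VTree.locate_eq_of_subtree hp.inl hT.1 hsub, VTree.locate, if_neg, if_neg]
    · intro h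
      obtain ⟨x, hx⟩ := hp
      exact Set.disjoint_left.1 hd (hpl hx) (h (Or.inl hx))
    · intro h
      obtain ⟨x, hx⟩ := hq
      exact Set.disjoint_right.1 hd (hqr hx) (h (Or.inr hx))
    · rw [VTree.vars_node]
      exact Set.union_subset_union hpl hqr
  rcases hv with hv | hv
  · exact ⟨l, r, key l r (Or.inl hg) hl hr hv.1 hv.2⟩
  · exact ⟨r, l, key r l (Or.inr hg) hr hl hv.2 hv.1⟩

theorem Splits.holds_iff {w p q : C.Node} (h : C.Splits T w p q) (a : V → Bool) :
    C.Holds a w ↔ C.Holds a p ∧ C.Holds a q := by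
  rcases h.1 with hg | hg
  · exact holds_and_iff hg
  · rw [holds_and_iff hg, and_comm]

theorem Splits.length_home_lt (hT : T.IsVTree) {w p q : C.Node} (h : C.Splits T w p q) :
    (C.home T p).leaves.length < (C.home T w).leaves.length ∧
      (C.home T q).leaves.length < (C.home T w).leaves.length := by
  obtain ⟨-, hp, hq, vl, vr, hw, hpl, hqr⟩ := h
  have hsub : VTree.Subtree (VTree.node vl vr) T := hw ▸ home_subtree w
  rw [hw]
  exact ⟨(home_subtree_of_subset hT hp (VTree.Subtree.refl.left.trans hsub)
      hpl).length_leaves_le.trans_lt (VTree.length_leaves_lt_node vl vr).1,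
    (home_subtree_of_subset hT hq (VTree.Subtree.refl.right.trans hsub)
      hqr).length_leaves_le.trans_lt (VTree.length_leaves_lt_node vl vr).2⟩

open Classical in
/-- The assignment that agrees with `a` on `W` and with `b` elsewhere. -/
noncomputable def glue (W : Set V) (a b : V → Bool) : V → Bool := fun x => if x ∈ W then a x else b x

theorem glue_of_notMem {W : Set V} (a b : V → Bool) (x : V) (hx : x ∉ W) :
    glue W a b x = b x := if_neg hx

theorem holds_glue_iff {W : Set V} {u : C.Node} (h : C.vars u ⊆ W) (a b : V → Bool) :
    C.Holds (glue W a b) u ↔ C.Holds a u :=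
  holds_congr u fun _ hx => if_pos (h hx)

/-- Nonconstancy of `u` excludes terminal gates that avoid the home. -/
theorem mem_pieces_of_terminal (hC : C.IsStructuredDDNNF T) (hT : T.IsVTree) {u w : C.Node}
    (hu : C.Useful T u) (hc : ¬ C.IsConstant u)
    (hw : C.Reach (C.context T u) (C.home T u).vars C.root w)
    (ht : C.Terminal (C.home T u).vars w) {a : V → Bool}
    (ha : ∀ x ∉ (C.home T u).vars, a x = C.context T u x) (haw : C.Holds a w) :
    w ∈ C.pieces T u := by
  obtain ⟨hor, hd | ⟨h1, h2⟩⟩ := ht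
  · exfalso
    -- Such a `w` is true for every choice of the home variables. If `u` is satisfied by some `a₁`,
    -- uniqueness of terminal gates puts `w` on a descent from `u`, so `u` is always true.
    refine hc (or_iff_not_imp_right.2 fun h a₀ => ?_)
    push Not at h
    obtain ⟨a₁, h₁⟩ := h
    set W := (C.home T u).vars
    set b := C.context T u
    have hvu : C.vars u ⊆ W := vars_subset_home hT u
    have hw' : ∀ a', C.Holds (glue W a' b) w := fun a' =>
      (holds_congr w fun x hx => by
        have hx := Set.disjoint_left.1 hd hx
        rw [glue_of_notMem _ _ _ hx, ha x hx]).2 haw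
    obtain ⟨t, r, tt, htt⟩ := hC.2.2.exists_terminal hT.1 (home_subtree u)
      (glue_of_notMem a₁ b) u ((holds_glue_iff hvu _ _).2 h₁)
    obtain rfl := Reach.terminal_unique hC.2.1 (glue_of_notMem a₁ b)
      (hu.reach_context.trans r) hw tt ⟨hor, Or.inl hd⟩ htt (hw' a₁)
    rw [← holds_glue_iff hvu a₀ b]
    exact r.holds (glue_of_notMem a₀ b) (hw' a₀)
  · exact ⟨hw, h1, h2, a, haw⟩

theorem terminal_of_mem_pieces {u w : C.Node} (h : w ∈ C.pieces T u) :
    C.Terminal (C.home T u).vars w := ⟨h.2.1.not_or, Or.inr ⟨h.2.1, h.2.2.1⟩⟩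

theorem exists_mem_pieces (hC : C.IsStructuredDDNNF T) (hT : T.IsVTree)
    (hroot : ∀ a, C.Holds a C.root) {u : C.Node} (hu : C.Useful T u)
    (hc : ¬ C.IsConstant u) (a : V → Bool) : ∃ w ∈ C.pieces T u, C.Holds a w := by
  obtain ⟨w, r, t, h⟩ := hC.2.2.exists_terminal hT.1 (home_subtree u)
    (glue_of_notMem a (C.context T u)) C.root (hroot _)
  have hw := mem_pieces_of_terminal hC hT hu hc r t (glue_of_notMem _ _) h
  exact ⟨w, hw, (holds_glue_iff hw.2.2.1 _ _).1 h⟩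

theorem pieces_disjoint (hC : C.IsStructuredDDNNF T) {u v w : C.Node} (hv : v ∈ C.pieces T u)
    (hw : w ∈ C.pieces T u) {a : V → Bool} (hav : C.Holds a v) (haw : C.Holds a w) : v = w :=
  Reach.terminal_unique hC.2.1 (glue_of_notMem a _) hv.1 hw.1 (terminal_of_mem_pieces hv)
    (terminal_of_mem_pieces hw) ((holds_glue_iff hv.2.2.1 _ _).2 hav)
    ((holds_glue_iff hw.2.2.1 _ _).2 haw)

/-- On a piece `u` is constant, so in the decomposition of `u` the sub belonging to that piece can
be a constant. -/
theorem holds_iff_reach_piece (hC : C.IsStructuredDDNNF T) (hT : T.IsVTree) {u w : C.Node}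
    (hu : C.Useful T u) (hw : w ∈ C.pieces T u) {a : V → Bool} (haw : C.Holds a w) :
    C.Holds a u ↔ C.Reach (C.context T u) (C.home T u).vars u w := by
  have hvu := vars_subset_home hT u
  rw [← holds_glue_iff hvu a (C.context T u)]
  have haw' := (holds_glue_iff hw.2.2.1 a (C.context T u)).2 haw
  refine ⟨fun h => ?_, fun h => h.holds (glue_of_notMem _ _) haw'⟩
  obtain ⟨t, r, tt, htt⟩ := hC.2.2.exists_terminal hT.1 (home_subtree u) (glue_of_notMem _ _) u h
  obtain rfl := Reach.terminal_unique hC.2.1 (glue_of_notMem a _) (hu.reach_context.trans r)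
    hw.1 tt (terminal_of_mem_pieces hw) htt haw'
  exact r

theorem useful_of_mem_pieces (hT : T.IsVTree) {u w p q : C.Node}
    (hw : w ∈ C.pieces T u) (hs : C.Splits T w p q) : C.Useful T p ∧ C.Useful T q := by
  obtain ⟨hr, -, hsub, a, ha⟩ := hw
  obtain ⟨hap, haq⟩ := (hs.holds_iff a).1 ha
  have hwu : VTree.Subtree (C.home T w) (C.home T u) := by
    refine home_subtree_of_subset hT ?_ (home_subtree u) hsub
    rcases hs.1 with hg | hg
    · exact vars_and hg ▸ hs.2.1.inl
    · exact vars_and hg ▸ hs.2.1.inr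
  have key : ∀ p q, (C.gate w = Gate.and p q ∨ C.gate w = Gate.and q p) →
      (C.vars p).Nonempty → C.Holds a q → VTree.Subtree (C.home T p) (C.home T w) →
      Disjoint (C.vars q) (C.home T p).vars → C.Useful T p := by
    intro p q hg hp haq hpw hd
    have hnd : ¬ Disjoint (C.vars p) (C.home T p).vars := by
      obtain ⟨x, hx⟩ := hp
      exact Set.not_disjoint_iff.2 ⟨x, hx, vars_subset_home hT p hx⟩
    have hpw' : C.vars p ⊆ C.vars w := by
      rcases hg with hg | hg <;> simp [vars_and hg]
    have hWu : C.vars q ⊆ (C.home T u).vars := by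
      refine Set.Subset.trans ?_ hsub
      rcases hg with hg | hg <;> simp [vars_and hg]
    -- The new context for `p` is the old one, completed on the home of `u` by an assignment
    -- satisfying `w`. It satisfies the sibling `q`, which permits the last step from `w` to `p`.
    refine ⟨glue (C.home T u).vars a (C.context T u), Relation.ReflTransGen.tail
      (Reach.mono (hpw.trans hwu).vars_subset (glue_of_notMem _ _)
        (fun h => hnd (h.mono_left hpw')) hr) ?_⟩
    have haq' := (holds_glue_iff hWu a (C.context T u)).2 haq
    rcases hg with hg | hg
    · exact .left hg hnd hd haq'
    · exact .right hg hnd hd haq'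
  obtain ⟨hg, hp, hq, vl, vr, hh, hpl, hqr⟩ := hs
  have hsubT : VTree.Subtree (VTree.node vl vr) T := hh ▸ home_subtree w
  have hd := (VTree.nodup_node.1 (hsubT.nodup hT.1)).2.2
  have hpl' := home_subtree_of_subset hT hp (VTree.Subtree.refl.left.trans hsubT) hpl
  have hqr' := home_subtree_of_subset hT hq (VTree.Subtree.refl.right.trans hsubT) hqr
  exact ⟨key p q hg hp haq (hh ▸ hpl'.left) (hd.symm.mono hqr hpl'.vars_subset),
    key q p hg.symm hq hap (hh ▸ hqr'.right) (hd.mono hpl hqr'.vars_subset)⟩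

end NNF

/-! ### Gates of the sentential decision diagram. -/

namespace NNF

variable {V H : Type*}

/-- The gates of the sentential decision diagram built from a circuit with gates `N`. -/
inductive SDDNode (N : Type) : Type
  | const (b : Bool)
  | value (u : N) (s : Bool)
  | elem (u : N) (s : Bool) (w : N)
  | conj (w : N)
  | conjElem (w : N) (s : Bool)
  | pairElem (u : N) (s i : Bool)
  | pairPrime (u : N) (s i : Bool)
  | pairSub (u : N) (s i : Bool)

namespace SDDNode

/-- An encoding of `SDDNode N` in a disjoint union of products. -/
def code {N : Type} :
    SDDNode N → (N × N × Bool) ⊕ N × (Fin 3 × Bool × Bool ⊕ Bool ⊕ Bool ⊕ Unit) ⊕ Bool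
  | const b => .inr (.inr b)
  | value u s => .inr (.inl (u, .inr (.inl s)))
  | elem u s w => .inl (u, w, s)
  | conj w => .inr (.inl (w, .inr (.inr (.inr ()))))
  | conjElem w s => .inr (.inl (w, .inr (.inr (.inl s))))
  | pairElem u s i => .inr (.inl (u, .inl (0, s, i)))
  | pairPrime u s i => .inr (.inl (u, .inl (1, s, i)))
  | pairSub u s i => .inr (.inl (u, .inl (2, s, i)))

theorem code_injective {N : Type} : Function.Injective (code (N := N)) := by
  intro x y h
  cases x <;> cases y <;> simp_all [code]

noncomputable instance {N : Type} [Fintype N] : Fintype (SDDNode N) :=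
  Fintype.ofInjective code code_injective

theorem card_le {N : Type} [Fintype N] :
    Fintype.card (SDDNode N) ≤ 2 * Fintype.card N ^ 2 + 17 * Fintype.card N + 2 := by
  refine (Fintype.card_le_of_injective code code_injective).trans (le_of_eq ?_)
  simp
  ring

end SDDNode

open SDDNode Classical

variable (C : NNF V) (T : VTree V)

/-- The prime and the sub into which the conjunction `w` splits. -/
noncomputable def parts (w : C.Node) : C.Node × C.Node :=
  Classical.epsilon fun pq => C.Splits T w pq.1 pq.2

/-- The gate that decides whether the value of `u` is `s`. -/
noncomputable def valueGate (u : C.Node) (s : Bool) : Gate (V ⊕ H) (SDDNode C.Node) :=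
  if C.IsConstant u then .const (decide ((∀ a, C.Holds a u) ↔ s = true))
  else match C.home T u with
    | .leaf x => .lit (.inl x) (decide (C.Holds (fun _ => true) u ↔ s = true))
    -- A node with two variables gets no auxiliary leaf, so here the function is expanded on the
    -- left variable.
    | .node (.leaf _) (.leaf _) => .or (Set.range (pairElem u s))
    | _ => .or (elem u s '' C.pieces T u)

/-- The gate that computes the function of the terminal gate `w`. -/
noncomputable def conjGate (w : C.Node) : Gate (V ⊕ H) (SDDNode C.Node) :=
  match C.gate w with
  | .lit x b => .lit (.inl x) b
  | _ => if C.Splits T w (C.parts T w).1 (C.parts T w).2 then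
      -- The element with the negated prime is omitted when the prime is valid, since primes must be
      -- satisfiable.
      .or (conjElem w '' {s | s = true ∨ ¬ ∀ a, C.Holds a (C.parts T w).1})
    else .const false

/-- The elements of the decomposition at `conjGate`. -/
noncomputable def conjElemGate (w : C.Node) (s : Bool) : Gate (V ⊕ H) (SDDNode C.Node) :=
  if C.Splits T w (C.parts T w).1 (C.parts T w).2 then
    .and (value (C.parts T w).1 s) (if s = true then value (C.parts T w).2 true else const false)
  else .const false

/-- The prime of the element that handles the value `i` of the left one of two variables. -/
noncomputable def pairPrimeGate (u : C.Node) (i : Bool) : Gate (V ⊕ H) (SDDNode C.Node) :=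
  match C.home T u with
  | .node (.leaf x) (.leaf _) => .lit (.inl x) i
  | _ => .const false

/-- The sub of the element that handles the value `i` of the left one of two variables. -/
noncomputable def pairSubGate (u : C.Node) (s i : Bool) : Gate (V ⊕ H) (SDDNode C.Node) :=
  match C.home T u with
  | .node (.leaf _) (.leaf y) =>
    if C.Holds (Function.update (fun _ => i) y true) u ↔
        C.Holds (Function.update (fun _ => i) y false) u then
      .const (decide (C.Holds (Function.update (fun _ => i) y true) u ↔ s = true))
    else .lit (.inl y) (decide (C.Holds (Function.update (fun _ => i) y true) u ↔ s = true))
  | _ => .const false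

/-- The gates of the sentential decision diagram. -/
noncomputable def sddGate : SDDNode C.Node → Gate (V ⊕ H) (SDDNode C.Node)
  | const b => .const b
  | value u s => C.valueGate T u s
  | elem u s w => .and (conj w)
      (const (decide (C.Reach (C.context T u) (C.home T u).vars u w ↔ s = true)))
  | conj w => C.conjGate T w
  | conjElem w s => C.conjElemGate T w s
  | pairElem u s i => .and (pairPrime u s i) (pairSub u s i)
  | pairPrime u _ i => C.pairPrimeGate T u i
  | pairSub u s i => C.pairSubGate T u s i

/-- A bound on the depth of the gates of the sentential decision diagram. -/
noncomputable def sddRank : SDDNode C.Node → ℕ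
  | const _ => 0
  -- For a fixed home the order is value, element, piece, element of the piece. The next value has a
  -- home with at least one leaf less, hence rank at most `5 * n - 1`.
  | value u _ => 5 * (C.home T u).leaves.length + 4
  | elem _ _ w => 5 * (C.home T w).leaves.length + 3
  | conj w => 5 * (C.home T w).leaves.length + 2
  | conjElem w _ => 5 * (C.home T w).leaves.length + 1
  | pairElem _ _ _ => 1
  | pairPrime _ _ _ => 0
  | pairSub _ _ _ => 0

variable {C T}

theorem sddRank_lt (hT : T.IsVTree) {v w : SDDNode C.Node}
    (h : w ∈ (C.sddGate (H := H) T v).children) : C.sddRank T w < C.sddRank T v := by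
  cases v with
  | const b => simp [sddGate, Gate.children] at h
  | value u s =>
    simp only [sddGate, valueGate] at h
    split_ifs at h
    · simp [Gate.children] at h
    · split at h
      · simp [Gate.children] at h
      · obtain ⟨i, rfl⟩ := h
        simp [sddRank]
      · obtain ⟨w, hw, rfl⟩ := h
        have := (home_subtree_of_mem_pieces hT hw).length_leaves_le
        simp only [sddRank]
        omega
  | elem u s w =>
    simp only [sddGate, Gate.children, Set.mem_insert_iff, Set.mem_singleton_iff] at h
    rcases h with rfl | rfl <;> simp [sddRank]
  | conj w =>
    simp only [sddGate, conjGate] at h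
    split at h
    · simp [Gate.children] at h
    · split_ifs at h
      · obtain ⟨i, -, rfl⟩ := h
        simp [sddRank]
      · simp [Gate.children] at h
  | conjElem w s =>
    simp only [sddGate, conjElemGate] at h
    split_ifs at h with hs
    · have := hs.length_home_lt hT
      simp only [Gate.children, Set.mem_insert_iff, Set.mem_singleton_iff] at h
      rcases h with rfl | rfl
      · simp only [sddRank]
        omega
      · simp only [sddRank]
        omega
    · have := hs.length_home_lt hT
      simp only [Gate.children, Set.mem_insert_iff, Set.mem_singleton_iff] at h
      rcases h with rfl | rfl
      · simp only [sddRank]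
        omega
      · simp [sddRank]
    · simp [Gate.children] at h
  | pairElem u s i =>
    simp only [sddGate, Gate.children, Set.mem_insert_iff, Set.mem_singleton_iff] at h
    rcases h with rfl | rfl <;> simp [sddRank]
  | pairPrime u s i =>
    simp only [sddGate, pairPrimeGate] at h
    split at h <;> simp [Gate.children] at h
  | pairSub u s i =>
    simp only [sddGate, pairSubGate] at h
    split at h
    · split_ifs at h <;> simp [Gate.children] at h
    · simp [Gate.children] at h

/-- The sentential decision diagram for the function computed at the gate `r` of `C`. -/
noncomputable abbrev toSDD (C : NNF V) (H : Type*) {T : VTree V} (hT : T.IsVTree) (r : C.Node) :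
    NNF (V ⊕ H) where
  Node := SDDNode C.Node
  finite := @SDDNode.instFintype _ C.finite
  gate := C.sddGate T
  acyclic := Subrelation.wf (sddRank_lt hT) (measure (C.sddRank T)).wf
  root := value r true

theorem size_toSDD_le (hT : T.IsVTree) (r : C.Node) :
    (C.toSDD H hT r).size ≤ 2 * C.size ^ 2 + 17 * C.size + 2 :=
  @SDDNode.card_le _ C.finite

/-! ### Semantics -/

theorem holds_toSDD_const (hT : T.IsVTree) (r : C.Node) (a : V ⊕ H → Bool) (b : Bool) :
    (C.toSDD H hT r).Holds a (const b) ↔ b = true := holds_const_iff rfl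

theorem holds_toSDD_elem (hT : T.IsVTree) (r u w : C.Node) (s : Bool) (a : V ⊕ H → Bool) :
    (C.toSDD H hT r).Holds a (elem u s w) ↔ (C.toSDD H hT r).Holds a (conj w) ∧
      (C.Reach (C.context T u) (C.home T u).vars u w ↔ s = true) := by
  rw [holds_and_iff (C := C.toSDD H hT r) rfl, holds_toSDD_const, decide_eq_true_iff]

theorem holds_toSDD_value_of_isConstant (hT : T.IsVTree) (r : C.Node) {u : C.Node}
    (hu : C.IsConstant u) (s : Bool) (a : V ⊕ H → Bool) :
    (C.toSDD H hT r).Holds a (value u s) ↔ (C.Holds (fun x => a (.inl x)) u ↔ s = true) := by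
  have hg : (C.toSDD H hT r).gate (value u s) =
      .const (decide ((∀ a, C.Holds a u) ↔ s = true)) := if_pos hu
  rw [holds_const_iff hg, decide_eq_true_iff]
  refine iff_congr ?_ Iff.rfl
  rcases hu with h | h <;> simp [h]

theorem holds_toSDD_value_of_leaf (hT : T.IsVTree) (r : C.Node) {u : C.Node}
    (hu : ¬ C.IsConstant u) {x : V} (hx : C.home T u = .leaf x) (s : Bool) (a : V ⊕ H → Bool) :
    (C.toSDD H hT r).Holds a (value u s) ↔ (C.Holds (fun x => a (.inl x)) u ↔ s = true) := by
  have hg : (C.toSDD H hT r).gate (value u s) =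
      .lit (.inl x) (decide (C.Holds (fun _ => true) u ↔ s = true)) := by
    change C.valueGate T u s = _
    rw [valueGate, if_neg hu, hx]
  have hv : ∀ y ∈ C.vars u, y = x := fun y hy => by
    simpa [hx, VTree.vars, VTree.leaves] using vars_subset_home hT u hy
  have key : ∀ a : V → Bool, C.Holds a u ↔ C.Holds (fun _ => a x) u := fun a =>
    holds_congr u fun y hy => by rw [hv y hy]
  have hne : ¬ (C.Holds (fun _ => true) u ↔ C.Holds (fun _ => false) u) := fun h => hu (by
    have h' : ∀ a : V → Bool, C.Holds a u ↔ C.Holds (fun _ => true) u := fun a => by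
      rw [key]
      cases a x
      · exact h.symm
      · rfl
    by_cases ht : C.Holds (fun _ => true) u
    · exact Or.inl fun a => (h' a).2 ht
    · exact Or.inr fun a h => ht ((h' a).1 h))
  rw [holds_lit_iff hg, key fun x => a (.inl x)]
  clear key hv
  by_cases h1 : C.Holds (fun _ => true) u <;> by_cases h2 : C.Holds (fun _ => false) u <;>
    cases a (.inl x) <;> cases s <;> simp_all

theorem holds_toSDD_pairPrime (hT : T.IsVTree) (r : C.Node) {u : C.Node} {x y : V}
    (hx : C.home T u = .node (.leaf x) (.leaf y)) (s i : Bool) (a : V ⊕ H → Bool) :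
    (C.toSDD H hT r).Holds a (pairPrime u s i) ↔ a (.inl x) = i := by
  refine holds_lit_iff (C := C.toSDD H hT r) ?_
  change C.pairPrimeGate T u i = _
  rw [pairPrimeGate, hx]

theorem holds_toSDD_pairSub (hT : T.IsVTree) (r : C.Node) {u : C.Node} {x y : V}
    (hx : C.home T u = .node (.leaf x) (.leaf y)) (s i : Bool) (a : V ⊕ H → Bool) :
    (C.toSDD H hT r).Holds a (pairSub u s i) ↔
      (C.Holds (Function.update (fun _ => i) y (a (.inl y))) u ↔ s = true) := by
  have hg : (C.toSDD H hT r).gate (pairSub u s i) = C.pairSubGate T u s i := rfl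
  rw [pairSubGate, hx] at hg
  dsimp only at hg
  split_ifs at hg with h
  · rw [holds_const_iff hg, decide_eq_true_iff]
    cases a (.inl y)
    · rw [h]
    · rfl
  · rw [holds_lit_iff hg]
    by_cases h1 : C.Holds (Function.update (fun _ => i) y true) u <;>
      by_cases h2 : C.Holds (Function.update (fun _ => i) y false) u <;>
        cases a (.inl y) <;> cases s <;> simp_all

theorem gate_toSDD_value_of_pair (hT : T.IsVTree) (r : C.Node) {u : C.Node}
    (hu : ¬ C.IsConstant u) {x y : V} (hx : C.home T u = .node (.leaf x) (.leaf y)) (s : Bool) :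
    (C.toSDD H hT r).gate (value u s) = .or (Set.range (pairElem u s)) := by
  change C.valueGate T u s = _
  rw [valueGate, if_neg hu, hx]

theorem holds_toSDD_value_of_pair (hT : T.IsVTree) (r : C.Node) {u : C.Node}
    (hu : ¬ C.IsConstant u) {x y : V} (hx : C.home T u = .node (.leaf x) (.leaf y)) (s : Bool)
    (a : V ⊕ H → Bool) :
    (C.toSDD H hT r).Holds a (value u s) ↔ (C.Holds (fun x => a (.inl x)) u ↔ s = true) := by
  have hxy : x ≠ y := by
    have h := (home_subtree u).nodup hT.1
    rw [hx] at h
    simpa [VTree.leaves] using h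
  have hv : ∀ z ∈ C.vars u, z = x ∨ z = y := fun z hz => by
    simpa [hx, VTree.vars, VTree.leaves] using vars_subset_home hT u hz
  have key : C.Holds (Function.update (fun _ => a (.inl x)) y (a (.inl y))) u ↔
      C.Holds (fun x => a (.inl x)) u := by
    refine holds_congr u fun z hz => ?_
    rcases hv z hz with rfl | rfl <;> simp [hxy]
  rw [holds_or_iff (gate_toSDD_value_of_pair hT r hu hx s), ← key]
  have he : ∀ i, (C.toSDD H hT r).Holds a (pairElem u s i) ↔ a (.inl x) = i ∧
      (C.Holds (Function.update (fun _ => i) y (a (.inl y))) u ↔ s = true) := fun i => by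
    rw [holds_and_iff (C := C.toSDD H hT r) rfl, holds_toSDD_pairPrime hT r hx,
      holds_toSDD_pairSub hT r hx]
  constructor
  · rintro ⟨_, ⟨i, rfl⟩, h⟩
    obtain ⟨rfl, h⟩ := (he i).1 h
    exact h
  · exact fun h => ⟨_, ⟨_, rfl⟩, (he _).2 ⟨rfl, h⟩⟩

theorem _root_.VTree.eq_leaf_or_pair (S : VTree V) (h : S.leaves.length ≤ 2) :
    (∃ x, S = .leaf x) ∨ ∃ x y, S = .node (.leaf x) (.leaf y) := by
  cases S with
  | leaf x => exact Or.inl ⟨x, rfl⟩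
  | node l r =>
    have key : ∀ t : VTree V, t.leaves.length ≤ 1 → ∃ x, t = .leaf x := by
      intro t ht
      cases t with
      | leaf x => exact ⟨x, rfl⟩
      | node l r =>
        have := l.length_leaves_pos
        have := r.length_leaves_pos
        simp only [VTree.leaves, List.length_append] at ht
        omega
    have := l.length_leaves_pos
    have := r.length_leaves_pos
    simp only [VTree.leaves, List.length_append] at h
    obtain ⟨x, rfl⟩ := key l (by omega)
    obtain ⟨y, rfl⟩ := key r (by omega)
    exact Or.inr ⟨x, y, rfl⟩

theorem gate_toSDD_value_of_large (hT : T.IsVTree) (r : C.Node) {u : C.Node}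
    (hu : ¬ C.IsConstant u) (hl : 2 < (C.home T u).leaves.length) (s : Bool) :
    (C.toSDD H hT r).gate (value u s) = .or (elem u s '' C.pieces T u) := by
  change C.valueGate T u s = _
  rw [valueGate, if_neg hu]
  split
  · simp_all [VTree.leaves]
  · simp_all [VTree.leaves]
  · rfl

theorem gate_toSDD_conj_of_lit (hT : T.IsVTree) (r : C.Node) {w : C.Node} {x : V} {b : Bool}
    (h : C.gate w = .lit x b) : (C.toSDD H hT r).gate (conj w) = .lit (.inl x) b := by
  change C.conjGate T w = _
  rw [conjGate, h]

theorem gate_toSDD_conj_of_splits (hT : T.IsVTree) (r : C.Node) {w : C.Node}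
    (h : C.Splits T w (C.parts T w).1 (C.parts T w).2) : (C.toSDD H hT r).gate (conj w) =
      .or (conjElem w '' {s | s = true ∨ ¬ ∀ a, C.Holds a (C.parts T w).1}) := by
  change C.conjGate T w = _
  rw [conjGate]
  split
  · rcases h.1 with hg | hg <;> simp_all
  · rw [if_pos h]

theorem gate_toSDD_conjElem_of_splits (hT : T.IsVTree) (r : C.Node) {w : C.Node}
    (h : C.Splits T w (C.parts T w).1 (C.parts T w).2) (s : Bool) :
    (C.toSDD H hT r).gate (conjElem w s) =
      .and (value (C.parts T w).1 s) (if s = true then value (C.parts T w).2 true else const false) :=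
  if_pos h

theorem splits_parts (hC : C.Respects T) (hT : T.IsVTree) {w l r : C.Node}
    (hg : C.gate w = Gate.and l r) (hl : (C.vars l).Nonempty) (hr : (C.vars r).Nonempty) :
    C.Splits T w (C.parts T w).1 (C.parts T w).2 := by
  obtain ⟨p, q, h⟩ := hC.exists_splits hT hg hl hr
  exact Classical.epsilon_spec (p := fun pq : C.Node × C.Node => C.Splits T w pq.1 pq.2)
    ⟨(p, q), h⟩

theorem IsAtom.lit_or_splits (hC : C.Respects T) (hT : T.IsVTree) {w : C.Node}
    (h : C.IsAtom w) : (∃ x b, C.gate w = .lit x b) ∨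
      C.Splits T w (C.parts T w).1 (C.parts T w).2 := by
  obtain h | ⟨l, r, hg, hl, hr⟩ := h
  · exact Or.inl h
  · exact Or.inr (splits_parts hC hT hg hl hr)

/-- Correctness of the two parts is a hypothesis, so that the lemma serves both inside the induction
on homes and after it. -/
theorem holds_toSDD_conj (hC : C.Respects T) (hT : T.IsVTree) (r : C.Node) {w : C.Node}
    (hw : C.IsAtom w) (a : V ⊕ H → Bool)
    (ih : C.Splits T w (C.parts T w).1 (C.parts T w).2 →
      (∀ s, (C.toSDD H hT r).Holds a (value (C.parts T w).1 s) ↔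
        (C.Holds (fun x => a (.inl x)) (C.parts T w).1 ↔ s = true)) ∧
      ∀ s, (C.toSDD H hT r).Holds a (value (C.parts T w).2 s) ↔
        (C.Holds (fun x => a (.inl x)) (C.parts T w).2 ↔ s = true)) :
    (C.toSDD H hT r).Holds a (conj w) ↔ C.Holds (fun x => a (.inl x)) w := by
  rcases hw.lit_or_splits hC hT with ⟨x, b, h⟩ | h
  · rw [holds_lit_iff (gate_toSDD_conj_of_lit hT r h), holds_lit_iff h]
  · obtain ⟨ih1, ih2⟩ := ih h
    rw [holds_or_iff (gate_toSDD_conj_of_splits hT r h), h.holds_iff]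
    constructor
    · rintro ⟨_, ⟨s, -, rfl⟩, hs⟩
      rw [holds_and_iff (gate_toSDD_conjElem_of_splits hT r h s), ih1] at hs
      cases s
      · simp [holds_toSDD_const] at hs
      · simpa [ih2] using hs
    · intro hpq
      refine ⟨_, ⟨true, Or.inl rfl, rfl⟩, ?_⟩
      rw [holds_and_iff (gate_toSDD_conjElem_of_splits hT r h true), ih1]
      simpa [ih2] using hpq

theorem holds_toSDD_value (hC : C.IsStructuredDDNNF T) (hT : T.IsVTree)
    (hroot : ∀ a, C.Holds a C.root) (r : C.Node) (a : V ⊕ H → Bool) (u : C.Node)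
    (hu : C.Useful T u) (s : Bool) :
    (C.toSDD H hT r).Holds a (value u s) ↔ (C.Holds (fun x => a (.inl x)) u ↔ s = true) := by
  induction h : (C.home T u).leaves.length using Nat.strong_induction_on generalizing u s with
  | _ n ih =>
    subst h
    by_cases hc : C.IsConstant u
    · exact holds_toSDD_value_of_isConstant hT r hc s a
    by_cases hl : (C.home T u).leaves.length ≤ 2
    · obtain ⟨x, hx⟩ | ⟨x, y, hx⟩ := VTree.eq_leaf_or_pair _ hl
      · exact holds_toSDD_value_of_leaf hT r hc hx s a
      · exact holds_toSDD_value_of_pair hT r hc hx s a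
    have hconj : ∀ w ∈ C.pieces T u,
        ((C.toSDD H hT r).Holds a (conj w) ↔ C.Holds (fun x => a (.inl x)) w) := by
      intro w hw
      refine holds_toSDD_conj hC.2.2 hT r hw.2.1 a fun hs => ?_
      have hlen := (home_subtree_of_mem_pieces hT hw).length_leaves_le
      have hlt := hs.length_home_lt hT
      have hus := useful_of_mem_pieces hT hw hs
      exact ⟨fun s => ih _ (hlt.1.trans_le hlen) _ hus.1 s rfl,
        fun s => ih _ (hlt.2.trans_le hlen) _ hus.2 s rfl⟩
    rw [holds_or_iff (gate_toSDD_value_of_large hT r hc (not_le.1 hl) s)]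
    constructor
    · rintro ⟨_, ⟨w, hw, rfl⟩, hs⟩
      rw [holds_toSDD_elem, hconj w hw] at hs
      rw [holds_iff_reach_piece hC hT hu hw hs.1]
      exact hs.2
    · intro h
      obtain ⟨w, hw, haw⟩ := exists_mem_pieces hC hT hroot hu hc fun x => a (.inl x)
      refine ⟨_, ⟨w, hw, rfl⟩, ?_⟩
      rw [holds_toSDD_elem, hconj w hw, ← holds_iff_reach_piece hC hT hu hw haw]
      exact ⟨haw, h⟩

theorem holds_toSDD_conj_of_mem_pieces (hC : C.IsStructuredDDNNF T) (hT : T.IsVTree)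
    (hroot : ∀ a, C.Holds a C.root) (r : C.Node) {u w : C.Node} (hw : w ∈ C.pieces T u)
    (a : V ⊕ H → Bool) :
    (C.toSDD H hT r).Holds a (conj w) ↔ C.Holds (fun x => a (.inl x)) w :=
  holds_toSDD_conj hC.2.2 hT r hw.2.1 a fun hs =>
    ⟨holds_toSDD_value hC hT hroot r a _ (useful_of_mem_pieces hT hw hs).1,
      holds_toSDD_value hC hT hroot r a _ (useful_of_mem_pieces hT hw hs).2⟩

/-! ### The circuit is a sentential decision diagram -/

theorem IsSDDAt.mono {C : NNF V} {u : C.Node} {S T : VTree V} (h : C.IsSDDAt u S)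
    (hST : VTree.Subtree S T) : C.IsSDDAt u T := by
  cases h with
  | const h => exact .const h
  | lit h hx => exact .lit h (hST.vars_subset hx)
  | decomposition p q h1 h2 h3 h4 h5 h6 h7 h8 =>
    exact .decomposition p q h1 (h2.trans hST) h3 h4 h5 h6 h7 h8

/-- A decomposition whose elements are indexed by a type. -/
theorem IsSDDAt.of_image {C : NNF V} {ι : Type*} {u : C.Node} {vL vR : VTree V} {J : Set ι}
    {e : ι → C.Node} (p q : ι → C.Node) (he : Function.Injective e)
    (hu : C.gate u = .or (e '' J)) (hg : ∀ i ∈ J, C.gate (e i) = .and (p i) (q i))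
    (hp : ∀ i ∈ J, C.IsSDDAt (p i) vL) (hq : ∀ i ∈ J, C.IsSDDAt (q i) vR)
    (hdisj : ∀ i ∈ J, ∀ j ∈ J, ∀ a, C.Holds a (p i) → C.Holds a (p j) → i = j)
    (hsat : ∀ i ∈ J, ∃ a, C.Holds a (p i)) (hcov : ∀ a, ∃ i ∈ J, C.Holds a (p i)) :
    C.IsSDDAt u (.node vL vR) := by
  obtain hι | hι := isEmpty_or_nonempty ι
  · obtain ⟨i, -⟩ := hcov fun _ => true
    exact hι.elim i
  -- `IsSDDAt` takes prime and sub as functions of the element gate, so the index is recovered from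
  -- the gate.
  have inv : ∀ i, Function.invFun e (e i) = i := Function.leftInverse_invFun he
  refine .decomposition (fun g => p (Function.invFun e g)) (fun g => q (Function.invFun e g))
    hu .refl ?_ ?_ ?_ ?_ ?_ ?_
  · rintro _ ⟨i, hi, rfl⟩
    simpa only [inv] using hg i hi
  · rintro _ ⟨i, hi, rfl⟩
    simpa only [inv] using hp i hi
  · rintro _ ⟨i, hi, rfl⟩
    simpa only [inv] using hq i hi
  · rintro _ ⟨i, hi, rfl⟩ _ ⟨j, hj, rfl⟩ hne a
    simp only [inv]
    rintro ⟨h1, h2⟩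
    exact hne (congrArg e (hdisj i hi j hj a h1 h2))
  · rintro _ ⟨i, hi, rfl⟩
    simpa only [inv] using hsat i hi
  · intro a
    obtain ⟨i, hi, h⟩ := hcov a
    exact ⟨_, ⟨i, hi, rfl⟩, by simpa only [inv] using h⟩

theorem isSDDAt_toSDD_value_of_pair (hT : T.IsVTree) (r : C.Node) {u : C.Node}
    (hu : ¬ C.IsConstant u) {x y : V} (hx : C.home T u = .node (.leaf x) (.leaf y)) (s : Bool) :
    (C.toSDD H hT r).IsSDDAt (value u s) (.node (.leaf (.inl x)) (.leaf (.inl y))) := by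
  have hp : ∀ i, (C.toSDD H hT r).gate (pairPrime u s i) = .lit (.inl x) i := by
    intro i
    change C.pairPrimeGate T u i = _
    rw [pairPrimeGate, hx]
  refine .of_image (e := pairElem u s) (J := Set.univ) (pairPrime u s) (pairSub u s) ?_ ?_
    (fun _ _ => rfl) ?_ ?_ ?_ ?_ ?_
  · intro i j h
    cases h
    rfl
  · rw [Set.image_univ]
    exact gate_toSDD_value_of_pair hT r hu hx s
  · exact fun i _ => .lit (hp i) (by simp [VTree.vars, VTree.leaves])
  · intro i _
    have hg : (C.toSDD H hT r).gate (pairSub u s i) = C.pairSubGate T u s i := rfl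
    rw [pairSubGate, hx] at hg
    dsimp only at hg
    split_ifs at hg
    · exact .const hg
    · exact .lit hg (by simp [VTree.vars, VTree.leaves])
  · intro i _ j _ a h1 h2
    rw [holds_toSDD_pairPrime hT r hx] at h1 h2
    exact h1.symm.trans h2
  · exact fun i _ => ⟨fun _ => i, (holds_toSDD_pairPrime hT r hx _ _ _).2 rfl⟩
  · exact fun a => ⟨_, trivial, (holds_toSDD_pairPrime hT r hx _ _ _).2 rfl⟩

/-- The primes are the first part and its negation. The negation is available because each value
gate carries a sign. -/
theorem isSDDAt_toSDD_conj_of_splits (hC : C.IsStructuredDDNNF T) (hT : T.IsVTree)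
    (hroot : ∀ a, C.Holds a C.root) (r : C.Node) {u w : C.Node} (hw : w ∈ C.pieces T u)
    (hs : C.Splits T w (C.parts T w).1 (C.parts T w).2) {l' r' : VTree (V ⊕ H)}
    (hp : ∀ s, (C.toSDD H hT r).IsSDDAt (value (C.parts T w).1 s) l')
    (hq : (C.toSDD H hT r).IsSDDAt (value (C.parts T w).2 true) r') :
    (C.toSDD H hT r).IsSDDAt (conj w) (.node l' r') := by
  have hus := useful_of_mem_pieces hT hw hs
  have sem := fun s a => holds_toSDD_value (H := H) hC hT hroot r a _ hus.1 s
  refine .of_image (e := conjElem w) (value (C.parts T w).1)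
    (fun s => if s = true then value (C.parts T w).2 true else const false) ?_
    (gate_toSDD_conj_of_splits hT r hs) (fun s _ => gate_toSDD_conjElem_of_splits hT r hs s)
    (fun s _ => hp s) ?_ ?_ ?_ ?_
  · intro i j h
    cases h
    rfl
  · intro s _
    cases s
    · exact .const (b := false) rfl
    · exact hq
  · intro i _ j _ a h1 h2
    have h := ((sem i a).1 h1).symm.trans ((sem j a).1 h2)
    exact Bool.eq_iff_iff.2 h
  · intro s h
    cases s
    · have h := h.resolve_left (by simp)
      push Not at h
      obtain ⟨a, ha⟩ := h
      refine ⟨Sum.elim a fun _ => true, (sem _ _).2 ?_⟩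
      simpa using ha
    · obtain ⟨a, ha⟩ := hw.2.2.2
      refine ⟨Sum.elim a fun _ => true, (sem _ _).2 ?_⟩
      simpa using ((hs.holds_iff a).1 ha).1
  · intro a
    refine ⟨decide (C.Holds (fun x => a (.inl x)) (C.parts T w).1), ?_, (sem _ _).2 (by simp)⟩
    by_cases h : C.Holds (fun x => a (.inl x)) (C.parts T w).1
    · exact Or.inl (by simp [h])
    · exact Or.inr fun h' => h (h' _)

/-- The counterpart is found below `v` itself and not merely below `v'`, so the pieces stay clear of
the auxiliary leaf of `v'`. -/
theorem _root_.VTree.IsModification.exists_node_of_subtree {a b l r : VTree V}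
    {l' r' : VTree (V ⊕ H)} (hl : VTree.IsModification l l') (hr : VTree.IsModification r r')
    (h : VTree.Subtree (.node a b) (.node l r)) :
    ∃ a' b', VTree.IsModification a a' ∧ VTree.IsModification b b' ∧
      VTree.Subtree (.node a' b') (.node l' r') := by
  cases h with
  | refl => exact ⟨_, _, hl, hr, .refl⟩
  | left h =>
    obtain ⟨S', hS, hsub⟩ := hl.exists_subtree h
    obtain ⟨a', b', ha, hb, hab⟩ := hS.exists_node
    exact ⟨a', b', ha, hb, (hab.trans hsub).left⟩
  | right h =>
    obtain ⟨S', hS, hsub⟩ := hr.exists_subtree h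
    obtain ⟨a', b', ha, hb, hab⟩ := hS.exists_node
    exact ⟨a', b', ha, hb, (hab.trans hsub).right⟩

theorem isSDDAt_toSDD_value (hC : C.IsStructuredDDNNF T) (hT : T.IsVTree)
    (hroot : ∀ a, C.Holds a C.root) (r u : C.Node) (hu : C.Useful T u) (s : Bool)
    {S' : VTree (V ⊕ H)} (hS : VTree.IsModification (C.home T u) S') :
    (C.toSDD H hT r).IsSDDAt (value u s) S' := by
  induction h : (C.home T u).leaves.length using Nat.strong_induction_on
    generalizing u s S' with
  | _ n ih =>
    subst h
    by_cases hc : C.IsConstant u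
    · exact .const (b := decide ((∀ a, C.Holds a u) ↔ s = true)) (if_pos hc)
    by_cases hlen : (C.home T u).leaves.length ≤ 2
    · obtain ⟨x, hx⟩ | ⟨x, y, hx⟩ := VTree.eq_leaf_or_pair _ hlen
      · rw [hx] at hS
        cases hS
        refine .lit (x := .inl x) (b := decide (C.Holds (fun _ => true) u ↔ s = true)) ?_
          (by simp [VTree.vars, VTree.leaves])
        change C.valueGate T u s = _
        rw [valueGate, if_neg hc, hx]
      · rw [hx] at hS
        obtain ⟨l', r', hl, hr, hsub⟩ := hS.exists_node
        cases hl
        cases hr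
        exact (isSDDAt_toSDD_value_of_pair hT r hc hx s).mono hsub
    rw [not_le] at hlen
    generalize hh : C.home T u = S at hS
    cases hS with
    | leaf x => simp [hh, VTree.leaves] at hlen
    | small hle => exact absurd (hh ▸ hlen) (not_lt.2 hle)
    -- The decomposition sits at `v'`: all pieces respect its left child `node l' r'`.
    | @large l r₀ l' r' x _ hl hr =>
      have hsubT : VTree.Subtree (.node l r₀) T := hh ▸ home_subtree u
      have hconj : ∀ w ∈ C.pieces T u, (C.toSDD H hT r).IsSDDAt (conj w) (.node l' r') := by
        intro w hw
        rcases hw.2.1.lit_or_splits hC.2.2 hT with ⟨x, b, h⟩ | hs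
        · refine .lit (gate_toSDD_conj_of_lit hT r h) ?_
          have hx : x ∈ (VTree.node l r₀).vars := hh ▸ hw.2.2.1 (by simp [vars_lit h])
          rw [VTree.vars_node] at hx ⊢
          exact hx.imp hl.inl_mem hr.inl_mem
        · have hwu := home_subtree_of_mem_pieces hT hw
          have hlt := hs.length_home_lt hT
          have hus := useful_of_mem_pieces hT hw hs
          obtain ⟨-, hp, hq, vl, vr, hwv, hpl, hqr⟩ := id hs
          rw [hh, hwv] at hwu
          obtain ⟨a', b', ha, hb, hab⟩ := hl.exists_node_of_subtree hr hwu
          have hvT := hwu.trans hsubT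
          obtain ⟨P, hP, hPs⟩ := ha.exists_subtree
            (home_subtree_of_subset hT hp (VTree.Subtree.refl.left.trans hvT) hpl)
          obtain ⟨Q, hQ, hQs⟩ := hb.exists_subtree
            (home_subtree_of_subset hT hq (VTree.Subtree.refl.right.trans hvT) hqr)
          have hle := (home_subtree_of_mem_pieces hT hw).length_leaves_le
          exact (isSDDAt_toSDD_conj_of_splits hC hT hroot r hw hs
            (fun s => (ih _ (hlt.1.trans_le hle) _ hus.1 s hP rfl).mono hPs)
            ((ih _ (hlt.2.trans_le hle) _ hus.2 true hQ rfl).mono hQs)).mono hab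
      have sem := fun w hw a =>
        holds_toSDD_conj_of_mem_pieces (H := H) hC hT hroot r (u := u) (w := w) hw a
      refine .of_image (e := elem u s) conj (fun w => const (decide
        (C.Reach (C.context T u) (C.home T u).vars u w ↔ s = true))) ?_
        (gate_toSDD_value_of_large hT r hc hlen s) (fun w _ => rfl) hconj
        -- Constants respect every vtree, so the auxiliary leaf can host them, and its variable need
        -- not occur in the circuit.
        (fun w _ => .const rfl) ?_ ?_ ?_
      · intro i j h
        cases h
        rfl
      · intro v hv w hw a h1 h2
        exact pieces_disjoint hC hv hw ((sem v hv a).1 h1) ((sem w hw a).1 h2)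
      · intro w hw
        obtain ⟨a, ha⟩ := hw.2.2.2
        exact ⟨Sum.elim a fun _ => true, (sem w hw _).2 ha⟩
      · intro a
        obtain ⟨w, hw, h⟩ := exists_mem_pieces hC hT hroot hu hc fun x => a (.inl x)
        exact ⟨w, hw, (sem w hw a).2 h⟩

end NNF

/-! ### Disjunction of two circuits. -/

namespace Gate

variable {V N M : Type*}

/-- Renaming the children of a gate. -/
def map (e : N → M) : Gate V N → Gate V M
  | lit x b => lit x b
  | const b => const b
  | and l r => and (e l) (e r)
  | or s => or (e '' s)

theorem children_map (e : N → M) (g : Gate V N) : (g.map e).children = e '' g.children := by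
  cases g <;> simp [map, children, Set.image_pair]

end Gate

namespace NNF

variable {V : Type*} {C D : NNF V}

/-- `e` identifies `C` with a part of `D` that is closed under taking children. -/
def IsEmbedding (e : C.Node → D.Node) : Prop := ∀ u, D.gate (e u) = (C.gate u).map e

namespace IsEmbedding

variable {e : C.Node → D.Node}

theorem holds_iff (he : IsEmbedding e) (a : V → Bool) (u : C.Node) :
    D.Holds a (e u) ↔ C.Holds a u := by
  induction u using C.acyclic.induction with
  | _ u ih =>
    have h := he u
    match hg : C.gate u with
    | .lit x c =>
      rw [hg] at h
      rw [holds_lit_iff hg, holds_lit_iff h]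
    | .const c =>
      rw [hg] at h
      rw [holds_const_iff hg, holds_const_iff h]
    | .and l r =>
      rw [hg] at h
      rw [holds_and_iff hg, holds_and_iff h, ih l (by simp [hg, Gate.children]),
        ih r (by simp [hg, Gate.children])]
    | .or s =>
      rw [hg] at h
      rw [holds_or_iff hg, holds_or_iff h, Set.exists_mem_image]
      exact exists_congr fun w => and_congr_right fun hw => ih w (by rwa [hg])

theorem vars_eq (he : IsEmbedding e) (u : C.Node) : D.vars (e u) = C.vars u := by
  induction u using C.acyclic.induction with
  | _ u ih =>
    ext x
    rw [mem_vars_iff, mem_vars_iff, he u, Gate.children_map, Set.exists_mem_image]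
    refine or_congr ?_ (exists_congr fun w => and_congr_right fun hw => by rw [ih w hw])
    cases C.gate u <;> simp [Gate.map]

theorem gate_eq_and (he : IsEmbedding e) {u : C.Node} {l r : D.Node}
    (h : D.gate (e u) = .and l r) : ∃ l' r', C.gate u = .and l' r' ∧ l = e l' ∧ r = e r' := by
  rw [he u] at h
  cases hg : C.gate u <;> simp_all [Gate.map]

theorem gate_eq_or (he : IsEmbedding e) {u : C.Node} {s : Set D.Node}
    (h : D.gate (e u) = .or s) : ∃ s', C.gate u = .or s' ∧ s = e '' s' := by
  rw [he u] at h
  cases hg : C.gate u <;> simp_all [Gate.map]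

end IsEmbedding

/-- The gates of the disjunction of two circuits. -/
def disjGate (C D : NNF V) : Option (C.Node ⊕ D.Node) → Gate V (Option (C.Node ⊕ D.Node))
  | none => .or {some (.inl C.root), some (.inr D.root)}
  | some (.inl u) => (C.gate u).map fun w => some (.inl w)
  | some (.inr u) => (D.gate u).map fun w => some (.inr w)

theorem disjGate_acyclic (C D : NNF V) :
    WellFounded fun w u => w ∈ (disjGate C D u).children := by
  have hl : ∀ u, Acc (fun w u => w ∈ (disjGate C D u).children) (some (.inl u)) := by
    intro u
    induction u using C.acyclic.induction with
    | _ u ih =>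
      refine ⟨_, fun w hw => ?_⟩
      rw [disjGate, Gate.children_map] at hw
      obtain ⟨w, hw, rfl⟩ := hw
      exact ih w hw
  have hr : ∀ u, Acc (fun w u => w ∈ (disjGate C D u).children) (some (.inr u)) := by
    intro u
    induction u using D.acyclic.induction with
    | _ u ih =>
      refine ⟨_, fun w hw => ?_⟩
      rw [disjGate, Gate.children_map] at hw
      obtain ⟨w, hw, rfl⟩ := hw
      exact ih w hw
  refine ⟨fun u => ?_⟩
  match u with
  | some (.inl u) => exact hl u
  | some (.inr u) => exact hr u
  | none =>
    refine ⟨_, fun w hw => ?_⟩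
    obtain rfl | rfl := hw
    · exact hl _
    · exact hr _

/-- The disjunction of two circuits. -/
abbrev disj (C D : NNF V) : NNF V where
  Node := Option (C.Node ⊕ D.Node)
  finite := @instFintypeOption _ (@instFintypeSum _ _ C.finite D.finite)
  gate := disjGate C D
  acyclic := disjGate_acyclic C D
  root := none

theorem size_disj (C D : NNF V) : (C.disj D).size = C.size + D.size + 1 := by
  let := C.finite
  let := D.finite
  exact (Fintype.card_option (α := C.Node ⊕ D.Node)).trans (by rw [Fintype.card_sum]; rfl)

theorem isEmbedding_disj_left (C D : NNF V) :
    IsEmbedding (C := C) (D := C.disj D) fun w => some (.inl w) := fun _ => rfl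

theorem isEmbedding_disj_right (C D : NNF V) :
    IsEmbedding (C := D) (D := C.disj D) fun w => some (.inr w) := fun _ => rfl

theorem IsStructuredDDNNF.disj {T : VTree V} (hC : C.IsStructuredDDNNF T)
    (hD : D.IsStructuredDDNNF T) (h : ∀ a, ¬ (C.Holds a C.root ∧ D.Holds a D.root)) :
    (C.disj D).IsStructuredDDNNF T := by
  have el := isEmbedding_disj_left C D
  have er := isEmbedding_disj_right C D
  refine ⟨?_, ?_, ?_⟩
  · intro u l r hg
    match u with
    | some (.inl u) =>
      obtain ⟨l, r, hg', rfl, rfl⟩ := el.gate_eq_and hg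
      rw [el.vars_eq, el.vars_eq]
      exact hC.1 u l r hg'
    | some (.inr u) =>
      obtain ⟨l, r, hg', rfl, rfl⟩ := er.gate_eq_and hg
      rw [er.vars_eq, er.vars_eq]
      exact hD.1 u l r hg'
    | none => simp [disjGate] at hg
  · intro u s hg
    match u with
    | some (.inl u) =>
      obtain ⟨s, hg', rfl⟩ := el.gate_eq_or hg
      rintro _ ⟨v, hv, rfl⟩ _ ⟨w, hw, rfl⟩ hne a
      rw [el.holds_iff, el.holds_iff]
      exact hC.2.1 u s hg' v hv w hw (fun h => hne (by rw [h])) a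
    | some (.inr u) =>
      obtain ⟨s, hg', rfl⟩ := er.gate_eq_or hg
      rintro _ ⟨v, hv, rfl⟩ _ ⟨w, hw, rfl⟩ hne a
      rw [er.holds_iff, er.holds_iff]
      exact hD.2.1 u s hg' v hv w hw (fun h => hne (by rw [h])) a
    | none =>
      obtain rfl : {some (.inl C.root), some (.inr D.root)} = s := Gate.or.inj hg
      have hl := fun a => el.holds_iff a C.root
      have hr := fun a => er.holds_iff a D.root
      rintro v (rfl | rfl) w (rfl | rfl) hne a
      · exact absurd rfl hne
      · rw [hl, hr]
        exact h a
      · rw [hl, hr, and_comm]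
        exact h a
      · exact absurd rfl hne
  · intro u l r hg
    match u with
    | some (.inl u) =>
      obtain ⟨l, r, hg', rfl, rfl⟩ := el.gate_eq_and hg
      rw [el.vars_eq, el.vars_eq]
      exact hC.2.2 u l r hg'
    | some (.inr u) =>
      obtain ⟨l, r, hg', rfl, rfl⟩ := er.gate_eq_and hg
      rw [er.vars_eq, er.vars_eq]
      exact hD.2.2 u l r hg'
    | none => simp [disjGate] at hg

end NNF

/-! ### Conclusion. -/

theorem mainTheorem1 :
    ∃ K : ℕ, ∀ (X : Type*) [Fintype X] (T : VTree X), T.IsVTree → T.Normalized →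
      ∀ (f : (X → Bool) → Bool) (D Dbar : NNF X),
        D.IsStructuredDDNNF T → Dbar.IsStructuredDDNNF T →
        D.Represents f → Dbar.Represents (fun a => !(f a)) →
        ∃ k : ℕ, k ≤ Fintype.card X - 2 ∧
          ∃ T' : VTree (X ⊕ Fin k), T'.IsVTree ∧ VTree.IsModification T T' ∧
            ∃ S : NNF (X ⊕ Fin k), S.IsSDD T' ∧
              S.Represents (fun a => f (fun x => a (Sum.inl x))) ∧
              S.size ≤ K * (D.size + Dbar.size) ^ 2 := by
  -- With `M = |D| + |Dbar|`, the disjunction has `M + 1` gates and the diagram at most `2(M+1)² +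
  -- 17(M+1) + 2 = 2M² + 21M + 21 ≤ 44M²`.
  refine ⟨44, ?_⟩
  intro X _ T hT _ f D E hD hE hf hf'
  obtain ⟨k, hk, T', hT', hmod⟩ := hT.exists_isModification
  refine ⟨k, hk, T', hT', hmod, ?_⟩
  have hC : (D.disj E).IsStructuredDDNNF T := hD.disj hE fun a => by
    rw [hf a, hf' a]
    simp
  have el := NNF.isEmbedding_disj_left D E
  have er := NNF.isEmbedding_disj_right D E
  have hroot : ∀ a, (D.disj E).Holds a (D.disj E).root := fun a => by
    rw [NNF.holds_or_iff (C := D.disj E) (u := none) rfl]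
    cases h : f a
    · exact ⟨_, Or.inr rfl, (er.holds_iff a E.root).2 ((hf' a).2 (by simp [h]))⟩
    · exact ⟨_, Or.inl rfl, (el.holds_iff a D.root).2 ((hf a).2 h)⟩
  -- The diagram is read off at the gate of `f` inside the valid circuit; one disjunction step
  -- reaches it in every context.
  set r : (D.disj E).Node := some (.inl D.root)
  have hr : (D.disj E).Useful T r :=
    ⟨fun _ => true, .single (.or (C := D.disj E) (u := none) rfl (Or.inl rfl))⟩
  obtain ⟨S', hS, hsub⟩ := hmod.exists_subtree (NNF.home_subtree (C := D.disj E) r)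
  refine ⟨(D.disj E).toSDD (Fin k) hT r, ?_, ?_, ?_⟩
  · exact (NNF.isSDDAt_toSDD_value hC hT hroot r r hr true hS).mono hsub
  · intro a
    refine (NNF.holds_toSDD_value hC hT hroot r a r hr true).trans ?_
    rw [el.holds_iff, hf]
    simp
  · refine (NNF.size_toSDD_le hT r).trans ?_
    rw [NNF.size_disj]
    have hpos : 0 < D.size := @Fintype.card_pos _ D.finite ⟨D.root⟩
    have hpos' : 0 < E.size := @Fintype.card_pos _ E.finite ⟨E.root⟩
    nlinarith
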